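/- **Setting.** Let $\Omega_1\subseteq\mathbb R^{d_1}$ and $\Omega_2\subseteq\mathbb R^{d_2}$ be open, $\Omega=\Omega_1\times\Omega_2$, and let $\|\cdot\|$ be the norm of $L^2(\Omega)=L^2(\Omega;\mathbb C)$. Let $\Delta$ be a self-adjoint realization of the Laplacian on $L^2(\Omega)$ (a self-adjoint operator acting as the classical Laplacian on $C_c^\infty(\Omega)$), with unitary group $e^{it\Delta}$. Let $V\in L^\infty(\Omega;\mathbb R)$, and let $C_V$ be the operator norm of $u\mapsto Vu$ on $L^2(\Omega)$. Let $h>0$ and $J\ge 1$, let $t_1<\dots<t_J$ be the Gauss–Legendre nodes on $[0,h]$ with Lagrange basis polynomials $\ell_1,\dots,\ell_J$, and set $$\Lambda_J=\frac1h\int_0^h\sum_{m=1}^J|\ell_m(s)|\,ds,\qquad \rho=h\,\Lambda_J\,C_V .$$ Assume $\rho<1$. For an initial value $w_0\in L^2(\Omega)$ and $\mathbf u=(u_1,\dots,u_J)\in L^2(\Omega)^J$ define $$\Phi_{w_0}\mathbf u(t)=e^{it\Delta}w_0-i\int_0^t\sum_{m=1}^J e^{i(t-t_m)\Delta}Vu_m\,\ell_m(s)\,ds,\qquad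 \mathbf\Phi_{w_0}\mathbf u=\big(\Phi_{w_0}\mathbf u(t_j)\big)_{1\le j\le J},\qquad \|\mathbf u\|_J=\max_{1\le j\le J}\|u_j\| .$$ For $v=\sum_k\sigma_k\,a_k\otimes b_k$ in singular value decomposition ($\sigma_1\ge\sigma_2\ge\dots\ge0$), let $\mathcal S_\alpha(v)=\sum_k\max\{\sigma_k-\alpha,0\}\,a_k\otimes b_k$, and let $\mathcal R_\delta(v)=\sum_{k\le r}\sigma_k\,a_k\otimes b_k$ with the smallest $r\in\mathbb N_0$ such that $\sum_{k>r}\sigma_k^2\le\delta^2$. Let $u_0^\diamond,u_0^*\in L^2(\Omega)$. * $u\in C([0,h];L^2(\Omega))$ is the (mild) solution of $i\partial_tu=-\Delta u+Vu$ with $u(0)=u_0^\diamond$, that is, $u(t)=e^{it\Delta}u_0^\diamond-i\int_0^te^{i(t-s)\Delta}Vu(s)\,ds$ on $[0,h]$. * $u^\diamond$ is the collocation solution on $[0,h]$ with initial value $u_0^\diamond$, that is, $u^\diamond(t)=\Phi_{u_0^\diamond}\big((u^\diamond(t_m))_{m}\big)(t)$ for $t\in[0,h]$. * $\tilde u(h)$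 is the output on $[0,h]$ of the Gauss–Legendre–Picard scheme with soft thresholding started at $u_0^*$, with tolerance $\varepsilon$ and recompression parameter $\delta\ge0$: put $\mathbf u^0=\mathbf 0$ and $u^{k+1}_j=\mathcal S_{\alpha_k}\big(\Phi_{u_0^*}\mathbf u^k(t_j)\big)$ with arbitrary thresholds $\alpha_k\ge0$, let $K\ge0$ be the first index with $\|\mathbf\Phi_{u_0^*}\mathbf u^K-\mathbf u^K\|_J\le\varepsilon$, and set $\tilde u(h)=\mathcal R_\delta\big(\Phi_{u_0^*}\mathbf u^K(h)\big)$. Assume that $(\partial_t-i\Delta+iV)^{2J+1}u^\diamond$ exists in $L^\infty(0,h;L^2(\Omega))$. Here $\partial_t-i\Delta+iV$ is understood in the mild sense: $g=(\partial_t-i\Delta+iV)w$ on $[0,h]$, for $w$ continuous and $g$ integrable with values in $L^2(\Omega)$, means $w(t)=e^{it\Delta}w(0)+\int_0^te^{i(t-s)\Delta}\big(g(s)-iVw(s)\big)\,ds$ for all $t\in[0,h]$. **Proposition 4.1.** Under these assumptions, $$\|u(h)-\tilde u(h)\|\le\delta+\frac{\rho\,\varepsilon}{1-\rho}+\|u_0^\diamond-u_0^*\|+\kappa_{2J}\,h^{2J+1},\qquad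 \kappa_{2J}=\frac{(J!)^4}{(2J+1)!\,\big((2J)!\big)^2}\,\big\|(\partial_t-i\Delta+iV)^{2J+1}u^\diamond\big\|_{L^\infty(0,h;L^2(\Omega))} .$$ -/

import Mathlib

open MeasureTheory Set
open scoped ENNReal ContDiff Laplacian Nat

noncomputable section

namespace LowRank

/-! ### The spatial setting: `L²(Ω₁)`, `L²(Ω₂)`, `L²(Ω₁ × Ω₂)` -/

/-- Euclidean space of dimension `d`. -/
abbrev Eu (d : ℕ) := EuclideanSpace ℝ (Fin d)

/-- Lebesgue measure on `Ω ⊆ ℝᵈ`. -/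
abbrev mu {d : ℕ} (Ω : Set (Eu d)) : Measure (Eu d) := volume.restrict Ω

/-- Lebesgue measure on `Ω₁ × Ω₂`. -/
abbrev muProd {d₁ d₂ : ℕ} (Ω₁ : Set (Eu d₁)) (Ω₂ : Set (Eu d₂)) : Measure (Eu d₁ × Eu d₂) :=
  (mu Ω₁).prod (mu Ω₂)

/-- The complex Hilbert space `L²(Ω)` of a factor domain. -/
abbrev L2 {d : ℕ} (Ω : Set (Eu d)) := Lp ℂ 2 (mu Ω)

/-- The complex Hilbert space `L²(Ω₁ × Ω₂)`. -/
abbrev L2Prod {d₁ d₂ : ℕ} (Ω₁ : Set (Eu d₁)) (Ω₂ : Set (Eu d₂)) := Lp ℂ 2 (muProd Ω₁ Ω₂)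

theorem memLp_tensor {d₁ d₂ : ℕ} {Ω₁ : Set (Eu d₁)} {Ω₂ : Set (Eu d₂)} (a : L2 Ω₁) (b : L2 Ω₂) :
    MemLp (fun x : Eu d₁ × Eu d₂ => a x.1 * b x.2) 2 (muProd Ω₁ Ω₂) := by
  have ha := Lp.memLp a
  have hb := Lp.memLp b
  refine (memLp_two_iff_integrable_sq_norm (ha.1.comp_fst.mul hb.1.comp_snd)).2 ?_
  have h := ((memLp_two_iff_integrable_sq_norm ha.1).1 ha).mul_prod
    ((memLp_two_iff_integrable_sq_norm hb.1).1 hb)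
  refine h.congr (Filter.Eventually.of_forall fun x => ?_)
  simp [mul_pow]

/-- The elementary tensor `a ⊗ b`, that is, the function `(x₁, x₂) ↦ a(x₁) b(x₂)`. -/
def tensor {d₁ d₂ : ℕ} {Ω₁ : Set (Eu d₁)} {Ω₂ : Set (Eu d₂)} (a : L2 Ω₁) (b : L2 Ω₂) :
    L2Prod Ω₁ Ω₂ :=
  (memLp_tensor a b).toLp

/-! ### The Laplacian and its unitary group -/

/-- `p` is a test function on `Ω₁ × Ω₂` (smooth, with compact support inside the domain). -/
def IsTestFunction {d₁ d₂ : ℕ} (Ω₁ : Set (Eu d₁)) (Ω₂ : Set (Eu d₂)) (p : Eu d₁ × Eu d₂ → ℂ) :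
    Prop :=
  ContDiff ℝ ∞ p ∧ HasCompactSupport p ∧ tsupport p ⊆ Ω₁ ×ˢ Ω₂

/-- The classical Laplacian `Δ = Δ₁ + Δ₂` of a function of `(x₁, x₂)`. -/
def classicalLaplacian {d₁ d₂ : ℕ} (p : Eu d₁ × Eu d₂ → ℂ) (x : Eu d₁ × Eu d₂) : ℂ :=
  Laplacian.laplacian (fun y : Eu d₁ => p (y, x.2)) x.1 +
    Laplacian.laplacian (fun y : Eu d₂ => p (x.1, y)) x.2

/-- `A` is a self-adjoint realization of the Laplacian on `L²(Ω₁ × Ω₂)`: a self-adjoint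
(hence densely defined) operator that acts as the classical Laplacian on test functions. The choice
of `A` is the choice of the (self-adjoint) boundary conditions. -/
def IsLaplacian {d₁ d₂ : ℕ} (Ω₁ : Set (Eu d₁)) (Ω₂ : Set (Eu d₂))
    (A : L2Prod Ω₁ Ω₂ →ₗ.[ℂ] L2Prod Ω₁ Ω₂) : Prop :=
  IsSelfAdjoint A ∧
    ∀ p : Eu d₁ × Eu d₂ → ℂ, IsTestFunction Ω₁ Ω₂ p →
      ∀ f g : L2Prod Ω₁ Ω₂, f =ᵐ[muProd Ω₁ Ω₂] p → g =ᵐ[muProd Ω₁ Ω₂] classicalLaplacian p →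
        (f, g) ∈ A.graph

section Hilbert

variable {H : Type*} [NormedAddCommGroup H] [InnerProductSpace ℂ H] [CompleteSpace H]

/-- `S` is the strongly continuous one-parameter unitary group with infinitesimal generator `iA`
(unitarity follows from the group law and the isometry property). -/
structure IsUnitaryGroup (A : H →ₗ.[ℂ] H) (S : ℝ → H →L[ℂ] H) : Prop where
  map_zero : S 0 = ContinuousLinearMap.id ℂ H
  map_add : ∀ s t, S (s + t) = (S s).comp (S t)
  norm_map : ∀ t x, ‖S t x‖ = ‖x‖
  continuous : ∀ x, Continuous fun t => S t x
  generator : ∀ x y : H, (x, y) ∈ A.graph ↔ HasDerivAt (fun t => S t x) (Complex.I • y) 0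

open Classical in
/-- The unitary group `e^{itA}`, `t ∈ ℝ`, of a self-adjoint operator `A`: the strongly continuous
unitary group with generator `iA`. It is unique, and for self-adjoint `A` it exists by Stone's
theorem; the value for operators without such a group is irrelevant. -/
def expI (A : H →ₗ.[ℂ] H) : ℝ → H →L[ℂ] H :=
  if hA : ∃ S, IsUnitaryGroup A S then hA.choose else fun _ => ContinuousLinearMap.id ℂ H

end Hilbert

/-! ### The potential -/

/-- The operator `u ↦ V u` of multiplication by a real-valued, essentially bounded potential. -/
def potential {d₁ d₂ : ℕ} {Ω₁ : Set (Eu d₁)} {Ω₂ : Set (Eu d₂)} (V : Lp ℝ ∞ (muProd Ω₁ Ω₂)) :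
    L2Prod Ω₁ Ω₂ →L[ℂ] L2Prod Ω₁ Ω₂ :=
  (ContinuousLinearMap.mul ℂ ℂ).holderL (muProd Ω₁ Ω₂) ∞ 2 2 (Complex.ofRealCLM.compLp V)

/-! ### Gauss–Legendre nodes on `[0, h]` -/

/-- `t₁ < ⋯ < t_J` are the Gauss–Legendre nodes on `[0, h]`: the `J` roots of the `J`-th Legendre
polynomial, transported to `[0, h]`. (`Polynomial.shiftedLegendre J` is the `J`-th Legendre
polynomial transported to `[0, 1]`.) -/
def IsGaussLegendre (h : ℝ) {J : ℕ} (t : Fin J → ℝ) : Prop :=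
  StrictMono t ∧ ∀ j, Polynomial.aeval (t j / h) (Polynomial.shiftedLegendre J) = 0

/-- The Lagrange basis polynomial `ℓ_m(s) = ∏_{j ≠ m} (s - t_j) / (t_m - t_j)`. -/
def ell {J : ℕ} (t : Fin J → ℝ) (m : Fin J) (s : ℝ) : ℝ :=
  (Lagrange.basis Finset.univ t m).eval s

/-- The averaged Lebesgue constant `Λ_J = (1/h) ∫₀ʰ ∑ₘ |ℓₘ(s)| ds`. -/
def lebesgueConst (h : ℝ) {J : ℕ} (t : Fin J → ℝ) : ℝ :=
  1 / h * ∫ s in (0 : ℝ)..h, ∑ m, |ell t m s|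

section Evolution

/- `S` stands for the group `e^{itΔ}` and `B` for the multiplication operator by `V`. -/
variable {H : Type*} [NormedAddCommGroup H] [InnerProductSpace ℂ H] [CompleteSpace H]

/-- The contraction constant `ρ = h Λ_J C_V`, where `C_V` is the norm of the operator `u ↦ V u`. -/
def rho (B : H →L[ℂ] H) (h : ℝ) {J : ℕ} (t : Fin J → ℝ) : ℝ :=
  h * lebesgueConst h t * ‖B‖

/-- `u` is the solution on `[0, h]` of the Schrödinger equation `i ∂ₜu = -Δu + Vu` with `u(0) = u₀`,
that is, the continuous function with
`u(τ) = e^{iτΔ} u₀ - i ∫₀^τ e^{i(τ-s)Δ} V u(s) ds`. -/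
def IsSchrodingerSolution (S : ℝ → H →L[ℂ] H) (B : H →L[ℂ] H) (h : ℝ) (u₀ : H) (u : ℝ → H) :
    Prop :=
  ContinuousOn u (Icc 0 h) ∧
    ∀ τ ∈ Icc 0 h, u τ = S τ u₀ - Complex.I • ∫ s in (0 : ℝ)..τ, S (τ - s) (B (u s))

/-- The Picard map in untwisted variables,
`Φ𝐮(τ) = e^{iτΔ} u₀ - i ∫₀^τ ∑ₘ e^{i(τ-tₘ)Δ} V uₘ ℓₘ(s) ds`. -/
def picard (S : ℝ → H →L[ℂ] H) (B : H →L[ℂ] H) {J : ℕ} (t : Fin J → ℝ) (u₀ : H)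
    (U : Fin J → H) (τ : ℝ) : H :=
  S τ u₀ - Complex.I •
    ∫ s in (0 : ℝ)..τ, ∑ m, ((ell t m s : ℝ) : ℂ) • S (τ - t m) (B (U m))

/-- `u` is the solution of the collocation formulation on `[0, h]` with initial value `u₀`. -/
def IsCollocationSolution (S : ℝ → H →L[ℂ] H) (B : H →L[ℂ] H) (h : ℝ) {J : ℕ} (t : Fin J → ℝ)
    (u₀ : H) (u : ℝ → H) : Prop :=
  ∀ τ ∈ Icc 0 h, u τ = picard S B t u₀ (fun m => u (t m)) τ

/-- `g = (∂ₜ - iΔ + iV) w` on `[0, h]`, for continuous `w` and integrable `g`, in the mild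
(Duhamel) sense: since `(∂ₜ - iΔ) w = e^{itΔ} ∂ₜ (e^{-itΔ} w)`, it says that the twisted function
`e^{-iτΔ} w(τ)` is the primitive of `e^{-isΔ} (g(s) - i V w(s))`. Every `w` that is continuously
differentiable in time with continuous values in the domain of `Δ` satisfies it with the literal
`g = ∂ₜw - iΔw + iVw`, but neither `∂ₜw` nor `Δw` has to exist separately. -/
def IsResidual (S : ℝ → H →L[ℂ] H) (B : H →L[ℂ] H) (h : ℝ) (w g : ℝ → H) : Prop :=
  ContinuousOn w (Icc 0 h) ∧ IntegrableOn g (Icc 0 h) ∧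
    ∀ τ ∈ Icc 0 h,
      w τ = S τ (w 0) + ∫ s in (0 : ℝ)..τ, S (τ - s) (g s - Complex.I • B (w s))

/-- `g = (∂ₜ - iΔ + iV)ⁿ w` on `[0, h]`. -/
def IsIteratedResidual (S : ℝ → H →L[ℂ] H) (B : H →L[ℂ] H) (h : ℝ) :
    ℕ → (ℝ → H) → (ℝ → H) → Prop
  | 0, w, g => EqOn g w (Icc 0 h)
  | n + 1, w, g => ∃ v, IsIteratedResidual S B h n w v ∧ IsResidual S B h v g

/-- `‖g‖_{𝒲(0,h)}`, the norm of `L^∞(0, h; H)`. -/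
def normW (h : ℝ) (g : ℝ → H) : ℝ :=
  (eLpNorm g ∞ (volume.restrict (Icc 0 h))).toReal

/-- `κ_{2J} = (J!)⁴ / ((2J+1)! ((2J)!)²) ‖g‖_{𝒲(0,h)}`, used with
`g = (∂ₜ - iΔ + iV)^{2J+1} u^⋄`. -/
def kappa (J : ℕ) (h : ℝ) (g : ℝ → H) : ℝ :=
  ((J ! : ℝ) ^ 4 / (((2 * J + 1)! : ℝ) * ((2 * J)! : ℝ) ^ 2)) * normW h g

end Evolution

/-! ### Singular value decomposition, soft thresholding, recompression -/

section LowRankOps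

variable {d₁ d₂ : ℕ} {Ω₁ : Set (Eu d₁)} {Ω₂ : Set (Eu d₂)}

/-- `v = ∑ₖ σₖ aₖ ⊗ bₖ` is a singular value decomposition of `v` (indexed from `k = 0`; only the
singular vectors that belong to nonzero singular values matter, which also covers finite rank). -/
structure IsSVD (v : L2Prod Ω₁ Ω₂) (σ : ℕ → ℝ) (a : ℕ → L2 Ω₁) (b : ℕ → L2 Ω₂) : Prop where
  nonneg : ∀ k, 0 ≤ σ k
  anti : Antitone σ
  orthonormal_left : Orthonormal ℂ fun k : {k // σ k ≠ 0} => a k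
  orthonormal_right : Orthonormal ℂ fun k : {k // σ k ≠ 0} => b k
  hasSum : HasSum (fun k => (σ k : ℂ) • tensor (a k) (b k)) v

/-- `w = 𝒮_α(v) = ∑ₖ max(σₖ - α, 0) aₖ ⊗ bₖ` (soft thresholding of the singular values). -/
def IsSoftThreshold (α : ℝ) (v w : L2Prod Ω₁ Ω₂) : Prop :=
  ∃ σ a b, IsSVD v σ a b ∧
    HasSum (fun k => ((max (σ k - α) 0 : ℝ) : ℂ) • tensor (a k) (b k)) w

/-- `w = ℛ_δ(v)`: truncation of a singular value decomposition of `v` to the smallest number `r` of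
terms with `∑_{k ≥ r} σₖ² ≤ δ²` (indices from `0`). -/
def IsRecompression (δ : ℝ) (v w : L2Prod Ω₁ Ω₂) : Prop :=
  ∃ σ a b, IsSVD v σ a b ∧
    ∃ r : ℕ, IsLeast {r : ℕ | ∑' k, σ (k + r) ^ 2 ≤ δ ^ 2} r ∧
      w = ∑ k ∈ Finset.range r, (σ k : ℂ) • tensor (a k) (b k)

/-- `uT = ũ(h)` is an output of the Gauss–Legendre–Picard scheme with soft thresholding on `[0, h]`,
started at `u₀`: starting from `𝐮⁰ = 0`, iterate `𝐮ᵏ⁺¹ = 𝒮_{αₖ}(Φ𝐮ᵏ)` (componentwise at the nodes)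
until the first `K` with `‖Φ𝐮ᴷ - 𝐮ᴷ‖_J ≤ ε`, then return `ℛ_δ(Φ𝐮ᴷ(h))`. The thresholds `αₖ ≥ 0` are
arbitrary, so that every strategy of decreasing them is covered. The norm on `Fin J → L²` is the
maximum norm. -/
def IsSchemeOutput (S : ℝ → L2Prod Ω₁ Ω₂ →L[ℂ] L2Prod Ω₁ Ω₂)
    (B : L2Prod Ω₁ Ω₂ →L[ℂ] L2Prod Ω₁ Ω₂) (h : ℝ) {J : ℕ} (t : Fin J → ℝ) (ε δ : ℝ)
    (u₀ uT : L2Prod Ω₁ Ω₂) : Prop :=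
  ∃ (α : ℕ → ℝ) (U : ℕ → Fin J → L2Prod Ω₁ Ω₂) (K : ℕ),
    (∀ k, 0 ≤ α k) ∧ U 0 = 0 ∧
    (∀ k < K, ∀ j, IsSoftThreshold (α k) (picard S B t u₀ (U k) (t j)) (U (k + 1) j)) ∧
    IsLeast {k : ℕ | ‖(fun j => picard S B t u₀ (U k) (t j)) - U k‖ ≤ ε} K ∧
    IsRecompression δ (picard S B t u₀ (U K) h) uT

end LowRankOps

end LowRank

end

/-! The error splits into four parts by the triangle inequality: exact against collocation solution,
collocation from `u₀d` against collocation from `u₀s`, exact collocation against the last Picard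
iterate, and recompression.

The first part is Gauss superconvergence with an explicit constant. Conjugation by the group removes
the Laplacian and leaves an equation with the bounded skew-adjoint generators `-i • twist S B s`.
Let `w n` be the twisted iterated residuals of the collocation solution and let `z` solve the
homogeneous equation backwards from the final error `e`. Skew-adjointness gives `d/ds Re⟨z, w n⟩ =
Re⟨z, w (n+1)⟩`, so `‖e‖²` is, up to sign, the integral of `Re⟨z, w 1⟩`. This function vanishes at
the nodes, so its integral is a pure Gauss quadrature error. It is bounded through the derivative of
order `2J`, which is at most `M‖z‖ = M‖e‖`, where `M` bounds the last residual; one factor `‖e‖`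
cancels (`IsHermitianFamily.norm_sub_le`). The constant is `∫ ω² / (2J)!` for the node polynomial
`ω` (`integral_nodePoly_sq`, `abs_integral_le_of_vanish_at_nodes`).

The second part is exactly `‖u₀d - u₀s‖`: the collocation equations are linear, and Gauss
collocation conserves the norm (`norm_picard_eq`) by its symplecticity (`weight_mul_weight`). The
third part is the a posteriori estimate for a `ρ`-contraction, with an extra factor `ρ` because the
iterate is read off after one more application of the Picard map (`norm_picard_sub_le_of_residual`).
The fourth is Pythagoras for the discarded singular values. -/

namespace LowRank

/-! ### Legendre polynomials and Gauss–Legendre quadrature -/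

section Legendre

open Polynomial

theorem intervalIntegrable_eval (p : ℝ[X]) (a b : ℝ) :
    IntervalIntegrable (fun s => p.eval s) volume a b :=
  p.continuous.intervalIntegrable a b

theorem integral_eval_derivative (p : ℝ[X]) (a b : ℝ) :
    ∫ s in a..b, p.derivative.eval s = p.eval b - p.eval a :=
  intervalIntegral.integral_eq_sub_of_hasDerivAt (fun x _ => p.hasDerivAt x) (intervalIntegrable_eval _ _ _)

theorem integral_derivative_mul_eval (p q : ℝ[X]) (a b : ℝ) :
    ∫ s in a..b, p.derivative.eval s * q.eval s =
      p.eval b * q.eval b - p.eval a * q.eval a - ∫ s in a..b, p.eval s * q.derivative.eval s := by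
  have h := integral_eval_derivative (p * q) a b
  simp only [derivative_mul, eval_add, eval_mul] at h
  rw [intervalIntegral.integral_add] at h
  · linarith
  · simpa using intervalIntegrable_eval (derivative p * q) a b
  · simpa using intervalIntegrable_eval (p * derivative q) a b

/-- Repeated integration by parts without boundary terms, intended for `W = X ^ n * (1 - X) ^ n` in
Rodrigues' formula. -/
theorem integral_iterate_derivative_mul_eval (W : ℝ[X]) (a b : ℝ) (m : ℕ)
    (ha : ∀ i < m, (derivative^[i] W).eval a = 0) (hb : ∀ i < m, (derivative^[i] W).eval b = 0)
    (q : ℝ[X]) :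
    ∫ s in a..b, (derivative^[m] W).eval s * q.eval s =
      (-1) ^ m * ∫ s in a..b, W.eval s * (derivative^[m] q).eval s := by
  induction m generalizing q with
  | zero => simp
  | succ m ih =>
    rw [Function.iterate_succ_apply', integral_derivative_mul_eval, ha m (by omega),
      hb m (by omega), ih (fun i hi => ha i (by omega)) (fun i hi => hb i (by omega)),
      Function.iterate_succ_apply, pow_succ]
    ring

theorem integral_pow_mul_one_sub_pow (a b : ℕ) :
    ∫ x in (0 : ℝ)..1, x ^ a * (1 - x) ^ b = (a ! * b ! : ℝ) / (a + b + 1)! := by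
  induction b generalizing a with
  | zero =>
    simp only [pow_zero, mul_one, integral_pow, one_pow, Nat.factorial_zero, Nat.cast_one,
      add_zero, Nat.factorial_succ a]
    have : (a ! : ℝ) ≠ 0 := by positivity
    push_cast
    field_simp
    simp
  | succ b ih =>
    have h := integral_derivative_mul_eval (X ^ (a + 1)) ((1 - X) ^ (b + 1)) 0 1
    simp only [derivative_pow, derivative_sub, derivative_one, derivative_X,
      eval_mul, eval_pow, eval_X, eval_sub, eval_one, eval_C, Nat.add_sub_cancel,
      eval_zero] at h
    have h1 : ∫ x in (0 : ℝ)..1, ((a + 1 : ℕ) : ℝ) * x ^ a * 1 * (1 - x) ^ (b + 1) =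
        ((a + 1 : ℕ) : ℝ) * ∫ x in (0 : ℝ)..1, x ^ a * (1 - x) ^ (b + 1) := by
      rw [← intervalIntegral.integral_const_mul]; congr 1; ext x; ring
    have h2 : ∫ x in (0 : ℝ)..1, x ^ (a + 1) * (((b + 1 : ℕ) : ℝ) * (1 - x) ^ b * (0 - 1)) =
        -(((b + 1 : ℕ) : ℝ) * ∫ x in (0 : ℝ)..1, x ^ (a + 1) * (1 - x) ^ b) := by
      rw [← intervalIntegral.integral_const_mul, ← intervalIntegral.integral_neg]; congr 1; ext x; ring
    rw [h1, h2, ih] at h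
    have e : a + 1 + b + 1 = a + (b + 1) + 1 := by ring
    rw [e] at h
    have h3 : ((a + 1 : ℕ) : ℝ) ≠ 0 := by positivity
    have h4 : ((a + (b + 1) + 1)! : ℝ) ≠ 0 := by positivity
    rw [eq_div_iff h4]
    apply mul_left_cancel₀ h3
    rw [← mul_assoc, h]
    rw [Nat.factorial_succ a, Nat.factorial_succ b]
    push_cast
    field_simp
    simp

/-- The Legendre polynomial on `[0, 1]` with real coefficients. -/
noncomputable def legendre (n : ℕ) : ℝ[X] := (shiftedLegendre n).map (Int.castRingHom ℝ)

theorem factorial_mul_legendre (n : ℕ) :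
    C (n ! : ℝ) * legendre n = derivative^[n] (X ^ n * (1 - X) ^ n) := by
  have h := congrArg (Polynomial.map (Int.castRingHom ℝ)) (factorial_mul_shiftedLegendre_eq n)
  rw [← iterate_derivative_map] at h
  simpa [legendre] using h

theorem degree_legendre (n : ℕ) : (legendre n).degree = n := by
  rw [legendre, degree_map_eq_of_injective (RingHom.injective_int _), degree_shiftedLegendre]

theorem leadingCoeff_legendre (n : ℕ) : (legendre n).leadingCoeff = (-1) ^ n * (2 * n).choose n := by
  rw [leadingCoeff, natDegree_eq_of_degree_eq_some (degree_legendre n), legendre, coeff_map,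
    coeff_shiftedLegendre]
  simp [two_mul]

/-- Rodrigues' formula and `n` integrations by parts. Orthogonality and the norming constant are
both read off from the right-hand side. -/
theorem integral_legendre_mul (n : ℕ) (q : ℝ[X]) :
    ∫ s in (0 : ℝ)..1, (legendre n).eval s * q.eval s =
      (-1) ^ n / n ! * ∫ s in (0 : ℝ)..1, s ^ n * (1 - s) ^ n * (derivative^[n] q).eval s := by
  have hn : (n ! : ℝ) ≠ 0 := by positivity
  have h := integral_iterate_derivative_mul_eval (X ^ n * (1 - X) ^ n) 0 1 n ?_ ?_ q
  · rw [← factorial_mul_legendre] at h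
    simp only [eval_mul, eval_C, eval_pow, eval_X, eval_sub, eval_one, mul_assoc] at h
    rw [intervalIntegral.integral_const_mul] at h
    field_simp
    simp only [mul_assoc]
    linarith
  · intro i hi
    have : (X : ℝ[X]) ^ (n - i) ∣ derivative^[i] (X ^ n * (1 - X) ^ n) :=
      pow_sub_dvd_iterate_derivative_of_pow_dvd i (dvd_mul_right _ _)
    obtain ⟨r, hr⟩ := this
    rw [hr]
    simp [show n - i ≠ 0 by omega]
  · intro i hi
    have : (1 - X : ℝ[X]) ^ (n - i) ∣ derivative^[i] (X ^ n * (1 - X) ^ n) :=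
      pow_sub_dvd_iterate_derivative_of_pow_dvd i (dvd_mul_left _ _)
    obtain ⟨r, hr⟩ := this
    rw [hr]
    simp [show n - i ≠ 0 by omega]

theorem integral_legendre_mul_eq_zero (n : ℕ) {q : ℝ[X]} (hq : q.degree < n) :
    ∫ s in (0 : ℝ)..1, (legendre n).eval s * q.eval s = 0 := by
  rw [integral_legendre_mul]
  by_cases h0 : q = 0
  · simp [h0]
  rw [iterate_derivative_eq_zero ((natDegree_lt_iff_degree_lt h0).2 hq)]
  simp

theorem integral_legendre_mul_monic (n : ℕ) {q : ℝ[X]} (hq : q.Monic) (hd : q.natDegree = n) :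
    ∫ s in (0 : ℝ)..1, (legendre n).eval s * q.eval s = (-1) ^ n * (n ! ^ 2 : ℝ) / (2 * n + 1)! := by
  have hn : (n ! : ℝ) ≠ 0 := by positivity
  have hD : derivative^[n] q = C (n ! : ℝ) := by
    have h0 : (derivative^[n] q).natDegree ≤ 0 := by
      simpa [hd] using natDegree_iterate_derivative q n
    rw [eq_C_of_natDegree_le_zero h0, coeff_iterate_derivative]
    have : q.coeff n = 1 := by rw [← hd]; exact hq
    simp [this, Nat.descFactorial_self]
  rw [integral_legendre_mul, hD]
  simp only [eval_C]
  rw [intervalIntegral.integral_mul_const, integral_pow_mul_one_sub_pow, two_mul]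
  field_simp

end Legendre

/-! ### The node polynomial on `[0, h]`: orthogonality and norm. -/

section Nodes

open Polynomial

variable {h : ℝ} {J : ℕ} {t : Fin J → ℝ}

/-- The monic polynomial that vanishes at the nodes. -/
noncomputable abbrev nodePoly (t : Fin J → ℝ) : ℝ[X] := Lagrange.nodal Finset.univ t

theorem sign_mul_choose_ne_zero (J : ℕ) : ((-1) ^ J * ((2 * J).choose J : ℝ)) ≠ 0 := by
  have : 0 < (2 * J).choose J := Nat.choose_pos (by omega)
  have : ((2 * J).choose J : ℝ) ≠ 0 := by positivity
  simp [this]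

/-- Both sides have degree `J` and the same leading coefficient, so their difference has degree
below `J`; it vanishes at `J` distinct points. -/
theorem legendre_eq_nodePoly (ht : IsGaussLegendre h t) (hh : 0 < h) :
    legendre J = C ((-1) ^ J * ((2 * J).choose J : ℝ)) * nodePoly (fun j => t j / h) := by
  have hinj : Function.Injective fun j => t j / h := fun i j hij =>
    ht.1.injective (by simpa [hh.ne'] using hij)
  have hl := leadingCoeff_legendre J
  have hd := degree_legendre J
  have hne := sign_mul_choose_ne_zero J
  refine Polynomial.eq_of_degree_sub_lt_of_eval_index_eq Finset.univ (v := fun j => t j / h)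
    (hinj.injOn) ?_ ?_
  · refine (degree_sub_lt_left ?_ ?_ ?_).trans_le ?_
    · rw [degree_C_mul hne, Lagrange.degree_nodal, hd]; simp
    · intro h0; rw [h0, leadingCoeff_zero] at hl; exact hne hl.symm
    · rw [hl, leadingCoeff_mul, leadingCoeff_C, (Lagrange.nodal_monic).leadingCoeff, mul_one]
    · simp [hd]
  · intro i _
    rw [eval_mul, Lagrange.eval_nodal_at_node (v := fun j => t j / h) (Finset.mem_univ i), mul_zero]
    have := ht.2 i
    rwa [aeval_def, eval₂_eq_eval_map] at this

theorem eval_nodePoly_mul (t : Fin J → ℝ) (hh : h ≠ 0) (x : ℝ) :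
    (nodePoly t).eval (h * x) = h ^ J * (nodePoly fun j => t j / h).eval x := by
  simp only [Lagrange.eval_nodal]
  have e : h ^ J = ∏ _i : Fin J, h := by simp
  rw [e, ← Finset.prod_mul_distrib]
  refine Finset.prod_congr rfl fun i _ => ?_
  field_simp

theorem integral_nodePoly_mul (ht : IsGaussLegendre h t) (hh : 0 < h) (q : ℝ[X]) :
    ((-1) ^ J * ((2 * J).choose J : ℝ)) * ∫ s in (0 : ℝ)..h, (nodePoly t).eval s * q.eval s =
      h ^ (J + 1) * ∫ x in (0 : ℝ)..1, (legendre J).eval x * (q.comp (C h * X)).eval x := by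
  have e := intervalIntegral.integral_comp_mul_left (a := 0) (b := 1)
    (fun s => (nodePoly t).eval s * q.eval s) hh.ne'
  simp only [mul_zero, mul_one, smul_eq_mul, eval_nodePoly_mul t hh.ne'] at e
  rw [legendre_eq_nodePoly ht hh]
  simp only [eval_mul, eval_C, eval_comp, eval_X, mul_assoc]
  simp only [mul_assoc] at e
  rw [intervalIntegral.integral_const_mul] at e
  simp only [intervalIntegral.integral_const_mul]
  have e2 : ∫ s in (0 : ℝ)..h, (nodePoly t).eval s * q.eval s = h * (h ^ J *
      ∫ x in (0 : ℝ)..1, (nodePoly fun j => t j / h).eval x * q.eval (h * x)) := by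
    rw [e]; field_simp
  rw [e2]
  ring

/-- The node polynomial is orthogonal to all polynomials of degree less than `J`. -/
theorem integral_nodePoly_mul_eq_zero (ht : IsGaussLegendre h t) (hh : 0 < h) {q : ℝ[X]}
    (hq : q.degree < J) : ∫ s in (0 : ℝ)..h, (nodePoly t).eval s * q.eval s = 0 := by
  have e := integral_nodePoly_mul ht hh q
  rw [integral_legendre_mul_eq_zero, mul_zero] at e
  · exact (mul_eq_zero.1 e).resolve_left (sign_mul_choose_ne_zero J)
  · by_cases h0 : q = 0
    · simp [h0]
    refine lt_of_le_of_lt degree_le_natDegree ?_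
    rw [natDegree_comp, natDegree_C_mul_X _ hh.ne', mul_one]
    exact_mod_cast (natDegree_lt_iff_degree_lt h0).2 hq

/-- One factor is replaced by the Legendre polynomial divided by its leading coefficient `±
(2J).choose J`. The other is monic after scaling, so `integral_legendre_mul_monic` evaluates the
integral. -/
theorem integral_nodePoly_sq (ht : IsGaussLegendre h t) (hh : 0 < h) :
    ∫ s in (0 : ℝ)..h, (nodePoly t).eval s ^ 2 =
      (J ! : ℝ) ^ 4 / (((2 * J + 1)! : ℝ) * ((2 * J)! : ℝ)) * h ^ (2 * J + 1) := by
  have e := integral_nodePoly_mul ht hh (nodePoly t)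
  have e1 : ∀ x, ((nodePoly t).comp (C h * X)).eval x =
      h ^ J * (nodePoly fun j => t j / h).eval x := by
    intro x
    simp [eval_nodePoly_mul t hh.ne']
  have e2 : ∫ x in (0 : ℝ)..1, (legendre J).eval x * ((nodePoly t).comp (C h * X)).eval x =
      h ^ J * ∫ x in (0 : ℝ)..1, (legendre J).eval x * (nodePoly fun j => t j / h).eval x := by
    rw [← intervalIntegral.integral_const_mul]
    congr 1
    ext x
    rw [e1]
    ring
  rw [e2, integral_legendre_mul_monic J (Lagrange.nodal_monic)
    (by rw [Lagrange.natDegree_nodal]; simp)] at e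
  have hc : ((2 * J).choose J : ℝ) * (J ! : ℝ) * (J ! : ℝ) = (2 * J)! := by
    have := Nat.choose_mul_factorial_mul_factorial (show J ≤ 2 * J by omega)
    rw [show 2 * J - J = J by omega] at this
    exact_mod_cast this
  have hJ : (J ! : ℝ) ≠ 0 := by positivity
  apply mul_left_cancel₀ (sign_mul_choose_ne_zero J)
  simp only [sq]
  rw [e, ← hc]
  have h3 : ((2 * J).choose J : ℝ) ≠ 0 := by
    have : 0 < (2 * J).choose J := Nat.choose_pos (by omega)
    positivity
  field_simp
  ring

end Nodes

/-! ### Gauss–Legendre quadrature: location of the nodes, exactness, symplecticity. -/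

section Quadrature

open Polynomial

variable {h : ℝ} {J : ℕ} {t : Fin J → ℝ}

theorem integral_mul_sq_pos {q : ℝ[X]} (hq : q ≠ 0) (hh : 0 < h) {l : ℝ → ℝ} (hl : Continuous l)
    (hpos : ∀ s ∈ Ioo 0 h, 0 < l s) : 0 < ∫ s in (0 : ℝ)..h, l s * q.eval s ^ 2 := by
  have hc : Continuous fun s => l s * q.eval s ^ 2 := hl.mul (q.continuous.pow 2)
  have hle : ∀ s ∈ Icc 0 h, 0 ≤ l s := by
    intro s hs
    rw [← closure_Ioo hh.ne] at hs
    exact closure_minimal (fun s hs => (hpos s hs).le) (isClosed_le continuous_const hl) hs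
  obtain ⟨s, hs, hs0⟩ : ∃ s ∈ Ioo 0 h, q.eval s ≠ 0 := by
    by_contra! H
    exact hq (Polynomial.eq_zero_of_infinite_isRoot q ((Ioo_infinite hh).mono H))
  refine intervalIntegral.integral_pos hh hc.continuousOn
    (fun s hs => mul_nonneg (hle s (Ioc_subset_Icc_self hs)) (sq_nonneg _))
    ⟨s, Ioo_subset_Icc_self hs, mul_pos (hpos s hs) (by positivity)⟩

/-- With the factor of `t j` removed from the node polynomial, orthogonality reads `∫ (s - t j)
q(s)² = 0`. This is impossible if `s - t j` has one sign on `(0, h)`. -/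
theorem IsGaussLegendre.mem_Ioo (ht : IsGaussLegendre h t) (hh : 0 < h) (j : Fin J) :
    t j ∈ Ioo 0 h := by
  classical
  set q : ℝ[X] := Lagrange.nodal (Finset.univ.erase j) t with hq
  have hq0 : q ≠ 0 := Lagrange.nodal_ne_zero
  have hdeg : q.degree < J := by
    rw [hq, Lagrange.degree_nodal, Finset.card_erase_of_mem (Finset.mem_univ j)]
    simp only [Finset.card_univ, Fintype.card_fin, Nat.cast_lt]
    have := j.pos
    omega
  have h0 := integral_nodePoly_mul_eq_zero ht hh hdeg
  have e : ∀ s, (nodePoly t).eval s * q.eval s = (s - t j) * q.eval s ^ 2 := by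
    intro s
    rw [nodePoly, Lagrange.nodal_eq_mul_nodal_erase (Finset.mem_univ j), eval_mul]
    simp only [eval_sub, eval_X, eval_C]
    rw [← hq]
    ring
  simp only [e] at h0
  by_contra hj
  rw [Set.mem_Ioo, not_and_or, not_lt, not_lt] at hj
  rcases hj with hj | hj
  · have := integral_mul_sq_pos hq0 hh (l := fun s => s - t j) (by fun_prop)
      (fun s hs => by have := hs.1; linarith)
    exact this.ne' h0
  · have := integral_mul_sq_pos hq0 hh (l := fun s => t j - s) (by fun_prop)
      (fun s hs => by have := hs.2; linarith)
    have e2 : ∫ s in (0 : ℝ)..h, (t j - s) * q.eval s ^ 2 =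
        -∫ s in (0 : ℝ)..h, (s - t j) * q.eval s ^ 2 := by
      rw [← intervalIntegral.integral_neg]
      congr 1
      ext s
      ring
    rw [e2, h0, neg_zero] at this
    exact lt_irrefl _ this

theorem ell_node (ht : Function.Injective t) (m : Fin J) : ell t m (t m) = 1 :=
  Lagrange.eval_basis_self ht.injOn (Finset.mem_univ m)

theorem ell_node_of_ne {m n : Fin J} (hmn : m ≠ n) : ell t m (t n) = 0 :=
  Lagrange.eval_basis_of_ne hmn (Finset.mem_univ n)

theorem sum_ell_node (ht : Function.Injective t) {E : Type*} [AddCommGroup E] [Module ℝ E]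
    (n : Fin J) (k : Fin J → E) : ∑ m, ell t m (t n) • k m = k n := by
  classical
  rw [Finset.sum_eq_single n, ell_node ht, one_smul]
  · intro m _ hm
    rw [ell_node_of_ne hm, zero_smul]
  · simp

theorem continuous_ell (t : Fin J → ℝ) (m : Fin J) : Continuous (ell t m) :=
  (Lagrange.basis Finset.univ t m).continuous

/-- The Gauss–Legendre quadrature weights. -/
noncomputable def weight (h : ℝ) (t : Fin J → ℝ) (m : Fin J) : ℝ := ∫ s in (0 : ℝ)..h, ell t m s

theorem integral_eval_of_degree_lt (ht : Function.Injective t) {p : ℝ[X]} (hp : p.degree < J) :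
    ∫ s in (0 : ℝ)..h, p.eval s = ∑ m, weight h t m * p.eval (t m) := by
  have e : p = Lagrange.interpolate Finset.univ t (fun m => p.eval (t m)) :=
    Lagrange.eq_interpolate ht.injOn (by simpa using hp)
  have e2 : ∀ s, p.eval s = ∑ m, p.eval (t m) * ell t m s := by
    intro s
    conv_lhs => rw [e, Lagrange.interpolate_apply, eval_finsetSum]
    simp [ell]
  rw [intervalIntegral.integral_congr (fun s _ => e2 s), intervalIntegral.integral_finsetSum
    (fun m _ => Continuous.intervalIntegrable
      (by have := continuous_ell t m; fun_prop) _ _)]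
  refine Finset.sum_congr rfl fun m _ => ?_
  rw [intervalIntegral.integral_const_mul, mul_comm, weight]

/-- The Gauss–Legendre quadrature rule is exact for polynomials of degree less than `2J`. -/
theorem integral_eval_eq_sum (ht : IsGaussLegendre h t) (hh : 0 < h) {p : ℝ[X]}
    (hp : p.degree < (2 * J : ℕ)) :
    ∫ s in (0 : ℝ)..h, p.eval s = ∑ m, weight h t m * p.eval (t m) := by
  have hmon : (nodePoly t).Monic := Lagrange.nodal_monic
  have hN : (nodePoly t).degree = J := by simp [nodePoly, Lagrange.degree_nodal]
  -- In `p = r + ω q` the term `ω q` vanishes at the nodes and integrates to zero by orthogonality;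
  -- `r` is handled by interpolation.
  set q := p /ₘ nodePoly t with hq
  set r := p %ₘ nodePoly t with hr
  have hpr : p = r + nodePoly t * q := (modByMonic_add_div p (nodePoly t)).symm
  have hrd : r.degree < J := hN ▸ degree_modByMonic_lt p hmon
  have hqd : q.degree < J := by
    by_cases hq0 : q = 0
    · rw [hq0, degree_zero]; exact WithBot.bot_lt_coe J
    by_cases hle : (nodePoly t).degree ≤ p.degree
    · have := degree_add_divByMonic hmon hle
      rw [← hq, hN, degree_eq_natDegree hq0] at this
      rw [← this] at hp
      rw [degree_eq_natDegree hq0]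
      have h3 : J + q.natDegree < 2 * J := by exact_mod_cast hp
      exact_mod_cast (by omega : q.natDegree < J)
    · exact absurd ((divByMonic_eq_zero_iff hmon).2 (not_le.1 hle)) hq0
  have he : ∀ m, p.eval (t m) = r.eval (t m) := by
    intro m
    conv_lhs => rw [hpr]
    rw [eval_add, eval_mul, Lagrange.eval_nodal_at_node (Finset.mem_univ m), zero_mul, add_zero]
  simp only [he]
  rw [← integral_eval_of_degree_lt ht.1.injective hrd]
  conv_lhs => rw [hpr]
  simp only [eval_add, eval_mul]
  rw [intervalIntegral.integral_add (intervalIntegrable_eval _ _ _)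
    (by simpa using intervalIntegrable_eval (nodePoly t * q) 0 h),
    integral_nodePoly_mul_eq_zero ht hh hqd, add_zero]

theorem exists_derivative_eq (p : ℝ[X]) : ∃ P : ℝ[X], derivative P = p ∧ P.eval 0 = 0 ∧
    P.natDegree ≤ p.natDegree + 1 := by
  refine ⟨∑ i ∈ Finset.range (p.natDegree + 1), C (p.coeff i / (i + 1)) * X ^ (i + 1), ?_, ?_, ?_⟩
  · conv_rhs => rw [p.as_sum_range_C_mul_X_pow]
    rw [derivative_sum]
    refine Finset.sum_congr rfl fun i _ => ?_
    rw [derivative_C_mul_X_pow]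
    have : (i : ℝ) + 1 ≠ 0 := by positivity
    push_cast
    rw [div_mul_cancel₀ _ this]
  · simp [eval_finsetSum]
  · refine natDegree_sum_le_of_forall_le _ _ fun i hi => (natDegree_C_mul_X_pow_le _ _).trans ?_
    have := Finset.mem_range.1 hi
    omega

/-- The symplecticity condition for the coefficients of the Gauss–Legendre collocation method. -/
theorem weight_mul_weight (ht : IsGaussLegendre h t) (hh : 0 < h) (m n : Fin J) :
    weight h t m * weight h t n = weight h t n * (∫ s in (0 : ℝ)..t n, ell t m s) +
      weight h t m * ∫ s in (0 : ℝ)..t m, ell t n s := by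
  have hdeg : ∀ m, (Lagrange.basis Finset.univ t m).natDegree = J - 1 := fun m => by
    rw [Lagrange.natDegree_basis ht.1.injective.injOn (Finset.mem_univ m)]; simp
  choose P hP hP0 hPd using fun m => exists_derivative_eq (Lagrange.basis Finset.univ t m)
  have hint : ∀ m a, ∫ s in (0 : ℝ)..a, ell t m s = (P m).eval a := by
    intro m a
    have := integral_eval_derivative (P m) 0 a
    rwa [hP, hP0, sub_zero] at this
  have hJ := m.pos
  -- The integrand has degree at most `(J - 1) + J = 2J - 1`, so Gauss quadrature is exact.
  -- Integrating `(P m * P n)'` over `[0, h]` then gives the identity.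
  have key : ∀ m n, ∫ s in (0 : ℝ)..h, ell t m s * (P n).eval s =
      weight h t m * (P n).eval (t m) := by
    intro m n
    have hq := integral_eval_eq_sum ht hh (p := Lagrange.basis Finset.univ t m * P n) (by
      refine lt_of_le_of_lt degree_le_natDegree (Nat.cast_lt.2 ?_)
      have h1 := natDegree_mul_le (p := Lagrange.basis Finset.univ t m) (q := P n)
      have h2 := hPd n
      rw [hdeg] at h1 h2
      omega)
    simp only [eval_mul] at hq
    rw [show (fun s => ell t m s * (P n).eval s) = fun s =>
      (Lagrange.basis Finset.univ t m).eval s * (P n).eval s from rfl, hq,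
      Finset.sum_eq_single m]
    · have := ell_node ht.1.injective m
      rw [ell] at this
      rw [this, one_mul]
    · intro k _ hk
      have := ell_node_of_ne (t := t) hk.symm
      rw [ell] at this
      rw [this, zero_mul, mul_zero]
    · simp
  have ibp := integral_derivative_mul_eval (P m) (P n) 0 h
  rw [hP, hP, hP0, hP0] at ibp
  have k1 := key m n
  have k2 := key n m
  simp only [ell] at k1 k2
  simp only [mul_comm ((P m).eval _) _] at ibp
  rw [k1, k2] at ibp
  rw [hint, hint, weight, weight, hint, hint] at *
  linarith

/-- The Lagrange basis sums to `1`. The bound serves to deduce `h * ‖B‖ < 1` from `ρ < 1`. -/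
theorem one_le_lebesgueConst (ht : Function.Injective t) (hJ : 1 ≤ J) (hh : 0 < h) :
    1 ≤ lebesgueConst h t := by
  have : Nonempty (Fin J) := ⟨⟨0, hJ⟩⟩
  have h1 : ∀ s, 1 ≤ ∑ m, |ell t m s| := by
    intro s
    have := congrArg (eval s) (Lagrange.sum_basis (s := Finset.univ) (v := t) ht.injOn
      Finset.univ_nonempty)
    rw [eval_finsetSum, eval_one] at this
    calc (1 : ℝ) = |∑ m, ell t m s| := by simp only [ell, this, abs_one]
      _ ≤ _ := Finset.abs_sum_le_sum_abs _ _
  have h2 : ∫ _s in (0 : ℝ)..h, (1 : ℝ) ≤ ∫ s in (0 : ℝ)..h, ∑ m, |ell t m s| :=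
    intervalIntegral.integral_mono_on hh.le (by simp)
      ((continuous_finsetSum _ fun m _ => (continuous_ell t m).abs).intervalIntegrable _ _)
      (fun s _ => h1 s)
  rw [intervalIntegral.integral_const, smul_eq_mul, mul_one, sub_zero] at h2
  rw [lebesgueConst, div_mul_eq_mul_div, one_mul, le_div_iff₀ hh, one_mul]
  exact h2

end Quadrature

/-! ### Hermite interpolation and the quadrature error. -/

section QuadratureError

open Polynomial

variable {h : ℝ} {J : ℕ} {t : Fin J → ℝ}

/-- Rolle's theorem for finite sets of zeros. -/
theorem exists_finset_deriv_zeros {f f' : ℝ → ℝ} (hc : ContinuousOn f (Icc 0 h))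
    (hd : ∀ x ∈ Ioo 0 h, HasDerivAt f (f' x) x) (Z : Finset ℝ) (k : ℕ) (hk : Z.card = k + 1)
    (hZ : ∀ x ∈ Z, x ∈ Icc 0 h ∧ f x = 0) :
    ∃ Z' : Finset ℝ, Z'.card = k ∧ Disjoint Z' Z ∧ ∀ x ∈ Z', x ∈ Icc 0 h ∧ f' x = 0 := by
  classical
  set x := Z.orderEmbOfFin hk with hx
  have hxm : ∀ i, x i ∈ Z := fun i => Z.orderEmbOfFin_mem hk i
  have hlt : ∀ i : Fin k, x i.castSucc < x i.succ := fun i =>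
    x.strictMono (Fin.castSucc_lt_succ)
  have hrolle : ∀ i : Fin k, ∃ y ∈ Ioo (x i.castSucc) (x i.succ), f' y = 0 := by
    intro i
    have h1 := (hZ _ (hxm i.castSucc))
    have h2 := (hZ _ (hxm i.succ))
    exact exists_hasDerivAt_eq_zero (hlt i) (hc.mono (Icc_subset_Icc h1.1.1 h2.1.2))
      (by rw [h1.2, h2.2])
      (fun y hy => hd y ⟨h1.1.1.trans_lt hy.1, hy.2.trans_le h2.1.2⟩)
  choose y hy hy0 using hrolle
  have hmono : StrictMono y := by
    intro i j hij
    refine (hy i).2.trans_le (le_trans ?_ (hy j).1.le)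
    exact x.monotone (by rw [Fin.le_def]; simp; omega)
  refine ⟨Finset.univ.image y, ?_, ?_, ?_⟩
  · rw [Finset.card_image_of_injective _ hmono.injective]; simp
  · rw [Finset.disjoint_left]
    intro z hz hzZ
    obtain ⟨i, -, rfl⟩ := Finset.mem_image.1 hz
    have : y i ∈ Set.range x := by rw [hx, Finset.range_orderEmbOfFin]; exact hzZ
    obtain ⟨j, hj⟩ := this
    have h3 := hy i
    rw [← hj] at h3
    -- A Rolle point equal to some `x j` would force `i < j < i + 1`. Disjointness matters because
    -- the old and new zeros are later counted together.
    have h4 := x.lt_iff_lt.1 h3.1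
    have h5 := x.lt_iff_lt.1 h3.2
    rw [Fin.lt_def] at h4 h5
    simp at h4 h5
    omega
  · intro z hz
    obtain ⟨i, -, rfl⟩ := Finset.mem_image.1 hz
    exact ⟨⟨(hZ _ (hxm i.castSucc)).1.1.trans (hy i).1.le,
      (hy i).2.le.trans (hZ _ (hxm i.succ)).1.2⟩, hy0 i⟩

/-- Repeated application of Rolle's theorem. -/
theorem exists_finset_iterate_deriv_zeros {F : ℕ → ℝ → ℝ} {N : ℕ}
    (hc : ∀ i < N, ContinuousOn (F i) (Icc 0 h))
    (hd : ∀ i < N, ∀ x ∈ Ioo 0 h, HasDerivAt (F i) (F (i + 1) x) x) (i j k : ℕ) (hij : i + j ≤ N)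
    (Z : Finset ℝ) (hk : Z.card = k + j) (hZ : ∀ x ∈ Z, x ∈ Icc 0 h ∧ F i x = 0) :
    ∃ Z' : Finset ℝ, Z'.card = k ∧ ∀ x ∈ Z', x ∈ Icc 0 h ∧ F (i + j) x = 0 := by
  induction j generalizing k with
  | zero => exact ⟨Z, hk, hZ⟩
  | succ j ih =>
    obtain ⟨Z₁, h1, h2⟩ := ih (k + 1) (by omega) (by omega)
    obtain ⟨Z₂, h3, -, h4⟩ := exists_finset_deriv_zeros (hc (i + j) (by omega))
      (hd (i + j) (by omega)) Z₁ k h1 h2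
    exact ⟨Z₂, h3, h4⟩

/-- The error of Hermite interpolation at the nodes, for functions whose derivative of order `2J-1`
is Lipschitz. -/
theorem exists_hermite_error (ht : Function.Injective t) (htI : ∀ j, t j ∈ Icc 0 h) (hJ : 1 ≤ J)
    {f : ℕ → ℝ → ℝ} {M : ℝ} (hc : ∀ i < 2 * J, ContinuousOn (f i) (Icc 0 h))
    (hd : ∀ i < 2 * J - 1, ∀ x ∈ Icc 0 h, HasDerivWithinAt (f i) (f (i + 1) x) (Icc 0 h) x)
    (hL : ∀ a ∈ Icc 0 h, ∀ b ∈ Icc 0 h, a ≤ b →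
      |f (2 * J - 1) b - f (2 * J - 1) a| ≤ M * (b - a))
    (h0 : ∀ j, f 0 (t j) = 0) :
    ∃ q : ℝ[X], q.degree < J ∧ ∀ s ∈ Icc 0 h,
      |f 0 s - (nodePoly t * q).eval s| ≤ M / (2 * J)! * (nodePoly t).eval s ^ 2 := by
  classical
  set w := nodePoly t with hw
  have hwt : ∀ j, w.eval (t j) = 0 := fun j => Lagrange.eval_nodal_at_node (Finset.mem_univ j)
  have hw' : ∀ j, (derivative w).eval (t j) ≠ 0 := by
    intro j
    rw [hw, Lagrange.eval_nodal_derivative_eval_node_eq (Finset.mem_univ j), Lagrange.eval_nodal]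
    refine Finset.prod_ne_zero_iff.2 fun i hi => sub_ne_zero.2 fun hij => ?_
    exact (Finset.mem_erase.1 hi).1 (ht hij).symm
  have hmon : w.Monic := Lagrange.nodal_monic
  have hwd : w.natDegree = J := by rw [hw, Lagrange.natDegree_nodal]; simp
  -- As `f 0` vanishes at the nodes, its Hermite interpolant is divisible by `w`. The values of `q`
  -- make `(w * q)' = f 1` at the nodes.
  set q := Lagrange.interpolate Finset.univ t (fun j => f 1 (t j) / (derivative w).eval (t j))
    with hq
  have hqd : q.degree < J := by
    have := Lagrange.degree_interpolate_lt (s := Finset.univ) (v := t)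
      (fun j => f 1 (t j) / (derivative w).eval (t j)) ht.injOn
    rwa [Finset.card_univ, Fintype.card_fin] at this
  have hqt : ∀ j, q.eval (t j) = f 1 (t j) / (derivative w).eval (t j) := fun j =>
    Lagrange.eval_interpolate_at_node _ ht.injOn (Finset.mem_univ j)
  have hqn : q.natDegree < J := by
    by_cases hq0 : q = 0
    · rw [hq0, natDegree_zero]; omega
    · exact (natDegree_lt_iff_degree_lt hq0).2 hqd
  refine ⟨q, hqd, fun s hs => ?_⟩
  by_cases hst : ∃ j, s = t j
  · obtain ⟨j, rfl⟩ := hst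
    simp [hwt, h0]
  push Not at hst
  have hws : w.eval s ≠ 0 := by
    rw [hw, Lagrange.eval_nodal]
    exact Finset.prod_ne_zero_iff.2 fun i _ => sub_ne_zero.2 (hst i)
  -- Chosen so that `f 0 - w * q - l * w ^ 2` has `s` as an additional zero, while the double zeros
  -- at the nodes remain.
  set l := (f 0 s - (w * q).eval s) / w.eval s ^ 2 with hl
  set R : ℝ[X] := w * q + C l * w ^ 2 with hR
  set F : ℕ → ℝ → ℝ := fun i x => f i x - (derivative^[i] R).eval x with hF
  have hFc : ∀ i < 2 * J, ContinuousOn (F i) (Icc 0 h) := fun i hi =>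
    (hc i hi).sub (Polynomial.continuousOn _)
  have hFd : ∀ i < 2 * J - 1, ∀ x ∈ Ioo 0 h, HasDerivAt (F i) (F (i + 1) x) x := by
    intro i hi x hx
    have h1 := (hd i hi x (Ioo_subset_Icc_self hx)).hasDerivAt (Icc_mem_nhds hx.1 hx.2)
    have h2 := (derivative^[i] R).hasDerivAt x
    rw [← Function.iterate_succ_apply' (f := derivative)] at h2
    exact h1.sub h2
  have hF0t : ∀ j, F 0 (t j) = 0 := by
    intro j
    simp [hF, hR, hwt, h0]
  have hF0s : F 0 s = 0 := by
    have : l * w.eval s ^ 2 = f 0 s - (w * q).eval s := by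
      rw [hl, div_mul_cancel₀]; positivity
    simp only [hF, hR, Function.iterate_zero, id, eval_add, eval_mul, eval_C, eval_pow] at this ⊢
    rw [this]
    ring
  have hF1t : ∀ j, F 1 (t j) = 0 := by
    intro j
    simp only [hF, hR, Function.iterate_one, derivative_add, derivative_mul, eval_add, eval_mul,
      derivative_C, eval_C, derivative_pow, hwt, hqt, eval_pow]
    have := hw' j
    field_simp
    simp
  set T : Finset ℝ := Finset.univ.image t with hT
  have hTc : T.card = J := by rw [hT, Finset.card_image_of_injective _ ht]; simp
  have hsT : s ∉ T := by
    simp only [hT, Finset.mem_image, Finset.mem_univ, true_and, not_exists]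
    exact fun j hj => hst j hj.symm
  -- The `J + 1` zeros of `F 0` give `J` zeros of `F 1` away from the nodes. With the nodes there
  -- are `2J`, and `2J - 2` further applications of Rolle leave two zeros of `F (2J - 1)`.
  obtain ⟨Y, hYc, hYd, hY⟩ := exists_finset_deriv_zeros (hFc 0 (by omega)) (hFd 0 (by omega))
    (insert s T) J (by rw [Finset.card_insert_of_notMem hsT, hTc]) (by
      intro x hx
      rcases Finset.mem_insert.1 hx with rfl | hx
      · exact ⟨hs, hF0s⟩
      · obtain ⟨j, -, rfl⟩ := Finset.mem_image.1 hx
        exact ⟨htI j, hF0t j⟩)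
  have hYT : Disjoint Y T := Finset.disjoint_of_subset_right (Finset.subset_insert s T) hYd
  obtain ⟨W, hWc, hW⟩ := exists_finset_iterate_deriv_zeros (N := 2 * J - 1)
    (fun i hi => hFc i (by omega)) hFd 1 (2 * J - 2) 2 (by omega) (Y ∪ T)
    (by rw [Finset.card_union_of_disjoint hYT, hYc, hTc]; omega) (by
      intro x hx
      rcases Finset.mem_union.1 hx with hx | hx
      · exact hY x hx
      · obtain ⟨j, -, rfl⟩ := Finset.mem_image.1 hx
        exact ⟨htI j, hF1t j⟩)
  rw [show 1 + (2 * J - 2) = 2 * J - 1 by omega] at hW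
  have hpair : ∃ a b, a < b ∧ a ∈ W ∧ b ∈ W := by
    obtain ⟨a, b, hab, rfl⟩ := Finset.card_eq_two.1 hWc
    rcases lt_or_gt_of_ne hab with h | h
    · exact ⟨a, b, h, by simp, by simp⟩
    · exact ⟨b, a, h, by simp, by simp⟩
  obtain ⟨a, b, hab, haW, hbW⟩ := hpair
  have hRd : R.natDegree ≤ 2 * J := by
    refine (natDegree_add_le _ _).trans (max_le ?_ ?_)
    · refine natDegree_mul_le.trans ?_; omega
    · refine (natDegree_C_mul_le _ _).trans (natDegree_pow_le.trans ?_); omega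
  have hRc : R.coeff (2 * J) = l := by
    have h2 : (w ^ 2).coeff (2 * J) = 1 := by
      have := (hmon.pow 2).coeff_natDegree
      rwa [hmon.natDegree_pow, hwd] at this
    rw [hR, coeff_add, coeff_C_mul, h2, coeff_eq_zero_of_natDegree_lt, zero_add, mul_one]
    refine natDegree_mul_le.trans_lt ?_; omega
  have hDd : (derivative^[2 * J - 1] R).natDegree ≤ 1 :=
    (natDegree_iterate_derivative _ _).trans (by omega)
  have hD1 : (derivative^[2 * J - 1] R).coeff 1 = (2 * J)! * l := by
    rw [coeff_iterate_derivative, show 1 + (2 * J - 1) = 2 * J by omega, hRc, nsmul_eq_mul]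
    congr 2
    have := Nat.factorial_mul_descFactorial (show 2 * J - 1 ≤ 2 * J by omega)
    rwa [show 2 * J - (2 * J - 1) = 1 by omega, Nat.factorial_one, one_mul] at this
  -- The derivative of `R` of order `2J - 1` is affine with slope `(2J)! * l`. Two zeros with the
  -- Lipschitz bound therefore replace one zero of a derivative of order `2J`, which need not exist.
  have hdiff : f (2 * J - 1) b - f (2 * J - 1) a = (2 * J)! * l * (b - a) := by
    have h1 := (hW a haW).2
    have h2 := (hW b hbW).2
    simp only [hF] at h1 h2
    rw [eq_X_add_C_of_natDegree_le_one hDd, hD1] at h1 h2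
    simp only [eval_add, eval_mul, eval_C, eval_X] at h1 h2
    linarith
  have hlM : (2 * J)! * |l| ≤ M := by
    have := hL a (hW a haW).1 b (hW b hbW).1 hab.le
    rw [hdiff, abs_mul, abs_mul, abs_of_pos (sub_pos.2 hab), Nat.abs_cast] at this
    exact le_of_mul_le_mul_right this (sub_pos.2 hab)
  have hfac : (0 : ℝ) < (2 * J)! := by positivity
  have hl2 : f 0 s - (w * q).eval s = l * w.eval s ^ 2 := by
    rw [hl, div_mul_cancel₀]; positivity
  rw [hl2, abs_mul, abs_of_nonneg (sq_nonneg (w.eval s))]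
  refine mul_le_mul_of_nonneg_right ?_ (sq_nonneg _)
  rw [le_div_iff₀ hfac]
  linarith

/-- The error of Gauss–Legendre quadrature for functions that vanish at the nodes. -/
theorem abs_integral_le_of_vanish_at_nodes (ht : IsGaussLegendre h t) (hh : 0 < h) (hJ : 1 ≤ J)
    {f : ℕ → ℝ → ℝ} {M : ℝ} (hc : ∀ i < 2 * J, ContinuousOn (f i) (Icc 0 h))
    (hd : ∀ i < 2 * J - 1, ∀ x ∈ Icc 0 h, HasDerivWithinAt (f i) (f (i + 1) x) (Icc 0 h) x)
    (hL : ∀ a ∈ Icc 0 h, ∀ b ∈ Icc 0 h, a ≤ b →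
      |f (2 * J - 1) b - f (2 * J - 1) a| ≤ M * (b - a))
    (h0 : ∀ j, f 0 (t j) = 0) :
    |∫ s in (0 : ℝ)..h, f 0 s| ≤
      (J ! : ℝ) ^ 4 / (((2 * J + 1)! : ℝ) * ((2 * J)! : ℝ) ^ 2) * M * h ^ (2 * J + 1) := by
  obtain ⟨q, hq, hqe⟩ := exists_hermite_error ht.1.injective
    (fun j => Ioo_subset_Icc_self (ht.mem_Ioo hh j)) hJ hc hd hL h0
  have hint : IntervalIntegrable (f 0) volume 0 h :=
    ContinuousOn.intervalIntegrable (by rw [uIcc_of_le hh.le]; exact hc 0 (by omega))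
  have e : ∫ s in (0 : ℝ)..h, f 0 s = ∫ s in (0 : ℝ)..h, (f 0 s - (nodePoly t * q).eval s) := by
    rw [intervalIntegral.integral_sub hint (intervalIntegrable_eval _ _ _)]
    simp only [eval_mul]
    rw [integral_nodePoly_mul_eq_zero ht hh hq, sub_zero]
  rw [e, ← Real.norm_eq_abs]
  have hg : IntervalIntegrable (fun s => M / (2 * J)! * (nodePoly t).eval s ^ 2) volume 0 h := by
    have := intervalIntegrable_eval (C (M / (2 * J)!) * nodePoly t ^ 2) 0 h
    simpa using this
  refine (intervalIntegral.norm_integral_le_of_norm_le hh.le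
    (Filter.Eventually.of_forall fun s hs => hqe s (Ioc_subset_Icc_self hs)) hg).trans_eq ?_
  rw [intervalIntegral.integral_const_mul, integral_nodePoly_sq ht hh]
  have : ((2 * J)! : ℝ) ≠ 0 := by positivity
  have : ((2 * J + 1)! : ℝ) ≠ 0 := by positivity
  field_simp

end QuadratureError

/-! ### Equations with bounded skew-adjoint generators, and superconvergence by duality. -/

section HermitianFamily

variable {H : Type*} [NormedAddCommGroup H] [InnerProductSpace ℂ H] {h β : ℝ}

/-- A jointly continuous family of symmetric operators with norms bounded by `β`. -/
structure IsHermitianFamily (β : ℝ) (Bt : ℝ → H →L[ℂ] H) : Prop where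
  symm : ∀ s x y, inner ℂ (Bt s x) y = inner ℂ x (Bt s y)
  norm_le : ∀ s x, ‖Bt s x‖ ≤ β * ‖x‖
  continuous : Continuous fun p : ℝ × H => Bt p.1 p.2

theorem hasDerivWithinAt_integral_of_continuousOn [CompleteSpace H] {F : ℝ → H}
    (hF : ContinuousOn F (Icc 0 h)) {x : ℝ} (hx : x ∈ Icc 0 h) :
    HasDerivWithinAt (fun τ => ∫ s in (0 : ℝ)..τ, F s) (F x) (Icc 0 h) x := by
  have hsub : uIcc 0 x ⊆ Icc 0 h := by
    rw [uIcc_of_le hx.1]; exact Icc_subset_Icc_right hx.2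
  have : Fact (x ∈ Icc 0 h) := ⟨hx⟩
  exact intervalIntegral.integral_hasDerivWithinAt_right (hF.mono hsub).intervalIntegrable
    (hF.stronglyMeasurableAtFilter_nhdsWithin measurableSet_Icc x) (hF x hx)

namespace IsHermitianFamily

variable {Bt : ℝ → H →L[ℂ] H}

theorem continuousOn_apply (hB : IsHermitianFamily β Bt) {s : Set ℝ} {w : ℝ → H}
    (hw : ContinuousOn w s) : ContinuousOn (fun τ => Bt τ (w τ)) s :=
  hB.continuous.comp_continuousOn (continuousOn_id.prodMk hw)

/-- `-i Bt s` is skew-adjoint, so its two contributions cancel; this is why no power of `‖B‖` enters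
the final constant. -/
theorem re_inner_add (hB : IsHermitianFamily β Bt) (s : ℝ) (p q P Q : H) :
    (inner ℂ p (Q - Complex.I • Bt s q) + inner ℂ (P - Complex.I • Bt s p) q).re =
      (inner ℂ P q).re + (inner ℂ p Q).re := by
  rw [inner_sub_right, inner_sub_left, inner_smul_right, inner_smul_left, hB.symm]
  simp
  ring

theorem hasDerivWithinAt_re_inner (hB : IsHermitianFamily β Bt) {p q : ℝ → H} {P Q : H} {s : ℝ}
    {T : Set ℝ} (hp : HasDerivWithinAt p (P - Complex.I • Bt s (p s)) T s)
    (hq : HasDerivWithinAt q (Q - Complex.I • Bt s (q s)) T s) :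
    HasDerivWithinAt (fun τ => (inner ℂ (p τ) (q τ)).re)
      ((inner ℂ P (q s)).re + (inner ℂ (p s) Q).re) T s := by
  have h1 := hp.inner ℂ hq
  have h2 := Complex.reCLM.hasFDerivAt.comp_hasDerivWithinAt s h1
  rw [← hB.re_inner_add s (p s) (q s) P Q]
  exact h2

theorem norm_eq_of_hasDerivWithinAt (hB : IsHermitianFamily β Bt) {z : ℝ → H}
    (hz : ∀ s ∈ Icc 0 h, HasDerivWithinAt z (-(Complex.I • Bt s (z s))) (Icc 0 h) s)
    {s : ℝ} (hs : s ∈ Icc 0 h) : ‖z s‖ = ‖z 0‖ := by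
  have hd : ∀ s ∈ Icc 0 h, HasDerivWithinAt (fun τ => (inner ℂ (z τ) (z τ)).re) 0 (Icc 0 h) s := by
    intro s hs
    have h1 : HasDerivWithinAt z (0 - Complex.I • Bt s (z s)) (Icc 0 h) s := by
      rw [zero_sub]; exact hz s hs
    simpa using hB.hasDerivWithinAt_re_inner h1 h1
  have h2 := constant_of_has_deriv_right_zero (fun s hs => (hd s hs).continuousWithinAt)
    (fun s hs => (hd s (Ico_subset_Icc_self hs)).mono_of_mem_nhdsWithin
      (Icc_mem_nhdsGE_of_mem hs)) s hs
  have e : ∀ x : H, (inner ℂ x x).re = ‖x‖ ^ 2 := fun x => by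
    rw [inner_self_eq_norm_sq_to_K]; norm_cast
  simp only [e] at h2
  exact (pow_left_inj₀ (norm_nonneg _) (norm_nonneg _) two_ne_zero).1 h2

theorem exists_solution [CompleteSpace H] (hB : IsHermitianFamily β Bt) (hβ : 0 ≤ β) (hh : 0 < h)
    (hβh : h * β < 1) (x : H) :
    ∃ z : ℝ → H, z h = x ∧
      ∀ s ∈ Icc 0 h, HasDerivWithinAt z (-(Complex.I • Bt s (z s))) (Icc 0 h) s := by
  have h1 : 0 < 1 - h * β := by linarith
  -- The radius solving `β * (‖x‖ + a) * h = a`, so that one Picard–Lindelöf step, started at the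
  -- right endpoint, covers all of `[0, h]`.
  set a : ℝ := h * β * ‖x‖ / (1 - h * β) with ha
  have ha0 : 0 ≤ a := by positivity
  have hnorm : ∀ s y, ‖-(Complex.I • Bt s y)‖ ≤ β * ‖y‖ := by
    intro s y
    rw [norm_neg, norm_smul, Complex.norm_I, one_mul]
    exact hB.norm_le s y
  have hPL : IsPicardLindelof (fun s y => -(Complex.I • Bt s y))
      (⟨h, right_mem_Icc.2 hh.le⟩ : Icc 0 h) x ⟨a, ha0⟩ 0
      ⟨β * (‖x‖ + a), by positivity⟩ ⟨β, hβ⟩ := by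
    refine ⟨fun s _ => LipschitzWith.lipschitzOnWith ?_, fun y _ => ?_, fun s _ y hy => ?_, ?_⟩
    · refine LipschitzWith.of_dist_le_mul fun y₁ y₂ => ?_
      rw [dist_eq_norm, dist_eq_norm]
      have : -(Complex.I • Bt s y₁) - -(Complex.I • Bt s y₂) = -(Complex.I • Bt s (y₁ - y₂)) := by
        rw [map_sub, smul_sub]; abel
      rw [this]
      exact hnorm s _
    · exact ((hB.continuousOn_apply continuousOn_const).const_smul Complex.I).neg
    · refine (hnorm s y).trans (mul_le_mul_of_nonneg_left ?_ hβ)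
      rw [mem_closedBall_iff_norm] at hy
      have := norm_sub_norm_le y x
      change ‖y - x‖ ≤ a at hy
      linarith
    · have : β * (‖x‖ + a) * h = a := by
        have e : a * (1 - h * β) = h * β * ‖x‖ := by rw [ha, div_mul_cancel₀ _ h1.ne']
        linarith
      change β * (‖x‖ + a) * max (h - h) (h - 0) ≤ a - 0
      rw [sub_self, sub_zero, sub_zero, max_eq_right hh.le, this]
  obtain ⟨z, hz, hz'⟩ := hPL.exists_eq_forall_mem_Icc_hasDerivWithinAt₀
  exact ⟨z, hz, hz'⟩

/-- `Re ⟨z, w⟩` is Lipschitz, where `z` solves the homogeneous equation and `w` solves the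
inhomogeneous equation with a bounded right-hand side. -/
theorem abs_re_inner_sub_le [CompleteSpace H] (hB : IsHermitianFamily β Bt) (hβ : 0 ≤ β)
    {M : ℝ} {z w G : ℝ → H}
    (hz : ∀ s ∈ Icc 0 h, HasDerivWithinAt z (-(Complex.I • Bt s (z s))) (Icc 0 h) s)
    (hw : ContinuousOn w (Icc 0 h)) (hG : IntegrableOn G (Icc 0 h))
    (hGM : ∀ᵐ s ∂volume.restrict (Icc 0 h), ‖G s‖ ≤ M)
    (hwG : ∀ τ ∈ Icc 0 h, w τ = w 0 + ∫ s in (0 : ℝ)..τ, (G s - Complex.I • Bt s (w s)))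
    {a b : ℝ} (ha : a ∈ Icc 0 h) (hb : b ∈ Icc 0 h) (hab : a ≤ b) :
    |(inner ℂ (z b) (w b)).re - (inner ℂ (z a) (w a)).re| ≤ M * ‖z 0‖ * (b - a) := by
  have hM : ∀ᵐ s, s ∈ Icc 0 h → ‖G s‖ ≤ M := (ae_restrict_iff' measurableSet_Icc).1 hGM
  have hzn : ∀ s ∈ Icc 0 h, ‖z s‖ = ‖z 0‖ := fun s hs => hB.norm_eq_of_hasDerivWithinAt hz hs
  obtain ⟨C, hC⟩ := isCompact_Icc.exists_bound_of_continuousOn hw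
  have hh : 0 ≤ h := ha.1.trans ha.2
  have hC0 : 0 ≤ C := (norm_nonneg _).trans (hC 0 ⟨le_rfl, hh⟩)
  set F : ℝ → H := fun s => G s - Complex.I • Bt s (w s) with hF
  have hBw : ContinuousOn (fun s => Complex.I • Bt s (w s)) (Icc 0 h) :=
    (hB.continuousOn_apply hw).const_smul Complex.I
  have hFi : IntegrableOn F (Icc 0 h) := hG.sub (hBw.integrableOn_Icc)
  have hFint : ∀ x ∈ Icc 0 h, ∀ y ∈ Icc 0 h, IntervalIntegrable F volume x y := by
    intro x hx y hy
    rw [intervalIntegrable_iff']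
    exact hFi.mono_set (uIcc_subset_Icc hx hy)
  have h0 : (0 : ℝ) ∈ Icc 0 h := ⟨le_rfl, hh⟩
  have hwsub : ∀ x ∈ Icc 0 h, ∀ y ∈ Icc 0 h, w y - w x = ∫ s in x..y, F s := by
    intro x hx y hy
    rw [hwG x hx, hwG y hy, ← intervalIntegral.integral_interval_sub_left (hFint 0 h0 y hy)
      (hFint 0 h0 x hx)]
    abel
  have hFM : ∀ᵐ s, s ∈ Icc 0 h → ‖F s‖ ≤ M + β * C := by
    filter_upwards [hM] with s hs hsI
    refine (norm_sub_le _ _).trans (add_le_add (hs hsI) ?_)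
    rw [norm_smul, Complex.norm_I, one_mul]
    exact (hB.norm_le s _).trans (mul_le_mul_of_nonneg_left (hC s hsI) hβ)
  have hwL : ∀ x ∈ Icc 0 h, ∀ y ∈ Icc 0 h, ‖w y - w x‖ ≤ (M + β * C) * |y - x| := by
    intro x hx y hy
    rw [hwsub x hx y hy]
    refine intervalIntegral.norm_integral_le_of_norm_le_const_ae ?_
    filter_upwards [hFM] with s hs hsI
    exact hs (uIcc_subset_Icc hx hy (uIoc_subset_uIcc hsI))
  have hzL : ∀ x ∈ Icc 0 h, ∀ y ∈ Icc 0 h, ‖z y - z x‖ ≤ β * ‖z 0‖ * |y - x| := by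
    intro x hx y hy
    refine Convex.norm_image_sub_le_of_norm_hasDerivWithin_le hz (fun s hs => ?_)
      (convex_Icc 0 h) hx hy
    rw [norm_neg, norm_smul, Complex.norm_I, one_mul, ← hzn s hs]
    exact hB.norm_le s _
  set D : ℝ → ℝ := fun s => (inner ℂ (z s) (w s)).re with hD
  have hre : ∀ x y : H, |(inner ℂ x y).re| ≤ ‖x‖ * ‖y‖ := fun x y =>
    (Complex.abs_re_le_norm _).trans (norm_inner_le_norm x y)
  -- This crude constant only provides absolute continuity. The sharp one comes from the almost
  -- everywhere derivative `Re⟨z, G⟩`, in which the generator cancels.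
  have hDL : LipschitzOnWith (Real.toNNReal (‖z 0‖ * (M + β * C) + β * ‖z 0‖ * C)) D (uIcc a b) := by
    refine LipschitzOnWith.of_dist_le_mul fun x hx y hy => ?_
    have hx' := uIcc_subset_Icc ha hb hx
    have hy' := uIcc_subset_Icc ha hb hy
    rw [Real.dist_eq, Real.dist_eq]
    have e : D x - D y = (inner ℂ (z x) (w x - w y)).re + (inner ℂ (z x - z y) (w y)).re := by
      simp only [hD, inner_sub_left, inner_sub_right, Complex.sub_re]; ring
    have h1 := hre (z x) (w x - w y)
    have h2 := hre (z x - z y) (w y)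
    have h3 : ‖z x‖ * ‖w x - w y‖ ≤ ‖z 0‖ * ((M + β * C) * |x - y|) := by
      rw [hzn x hx']
      exact mul_le_mul_of_nonneg_left (hwL y hy' x hx') (norm_nonneg _)
    have h4 : ‖z x - z y‖ * ‖w y‖ ≤ β * ‖z 0‖ * |x - y| * C :=
      mul_le_mul (hzL y hy' x hx') (hC y hy') (norm_nonneg _) (by positivity)
    calc |D x - D y| ≤ _ := (congrArg abs e).le.trans (abs_add_le _ _)
      _ ≤ (‖z 0‖ * (M + β * C) + β * ‖z 0‖ * C) * |x - y| := by linarith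
      _ ≤ _ := mul_le_mul_of_nonneg_right (Real.le_coe_toNNReal _) (abs_nonneg _)
  have hftc := hDL.absolutelyContinuousOnInterval.integral_deriv_eq_sub
  change |D b - D a| ≤ _
  rw [← hftc, ← Real.norm_eq_abs, ← abs_of_nonneg (sub_nonneg.2 hab)]
  refine intervalIntegral.norm_integral_le_of_norm_le_const_ae ?_
  have hne : ∀ᵐ s : ℝ, s ≠ b := by simp [ae_iff, measure_singleton]
  filter_upwards [hM, hne, (hFint 0 h0 h ⟨hh, le_rfl⟩).ae_hasDerivAt_integral] with s hs hsb hsF hsI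
  rw [uIoc_of_le hab] at hsI
  have hsO : s ∈ Ioo 0 h :=
    ⟨ha.1.trans_lt hsI.1, (lt_of_le_of_ne hsI.2 hsb).trans_le hb.2⟩
  have hsC := Ioo_subset_Icc_self hsO
  have hnhds : Icc 0 h ∈ nhds s := Icc_mem_nhds hsO.1 hsO.2
  have hwd : HasDerivAt w (F s) s := by
    refine HasDerivAt.congr_of_eventuallyEq
      ((hsF (by rwa [uIcc_of_le hh]) 0 (by rwa [uIcc_of_le hh])).const_add (w 0)) ?_
    filter_upwards [hnhds] with τ hτ
    exact hwG τ hτ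
  have hzd : HasDerivWithinAt z (0 - Complex.I • Bt s (z s)) (Icc 0 h) s := by
    rw [zero_sub]; exact hz s hsC
  have hDd := (hB.hasDerivWithinAt_re_inner hzd hwd.hasDerivWithinAt).hasDerivAt hnhds
  rw [hDd.deriv, inner_zero_left, Complex.zero_re, zero_add, Real.norm_eq_abs, mul_comm M]
  refine (hre _ _).trans ?_
  rw [hzn s hsC]
  exact mul_le_mul_of_nonneg_left (hs hsC) (norm_nonneg _)

/-- Superconvergence: if `w₀, w₁, …` are the iterated residuals of an approximation `w₀` of the
solution `y` and `w₁` vanishes at the Gauss–Legendre nodes, then the error at the end of the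
interval is controlled by the iterated residual of order `2J+1`. -/
theorem norm_sub_le [CompleteSpace H] (hB : IsHermitianFamily β Bt) (hβ : 0 ≤ β) (hh : 0 < h)
    (hβh : h * β < 1) {J : ℕ} (hJ : 1 ≤ J) {t : Fin J → ℝ} (ht : IsGaussLegendre h t)
    {y G : ℝ → H} {w : ℕ → ℝ → H} {M : ℝ}
    (hy : ∀ s ∈ Icc 0 h, HasDerivWithinAt y (-(Complex.I • Bt s (y s))) (Icc 0 h) s)
    (hy0 : y 0 = w 0 0)
    (hwc : ContinuousOn (w (2 * J)) (Icc 0 h))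
    (hwd : ∀ n < 2 * J, ∀ s ∈ Icc 0 h,
      HasDerivWithinAt (w n) (w (n + 1) s - Complex.I • Bt s (w n s)) (Icc 0 h) s)
    (hw1 : ∀ j, w 1 (t j) = 0)
    (hG : IntegrableOn G (Icc 0 h))
    (hGM : ∀ᵐ s ∂volume.restrict (Icc 0 h), ‖G s‖ ≤ M)
    (hwG : ∀ τ ∈ Icc 0 h, w (2 * J) τ =
      w (2 * J) 0 + ∫ s in (0 : ℝ)..τ, (G s - Complex.I • Bt s (w (2 * J) s))) :
    ‖y h - w 0 h‖ ≤
      (J ! : ℝ) ^ 4 / (((2 * J + 1)! : ℝ) * ((2 * J)! : ℝ) ^ 2) * M * h ^ (2 * J + 1) := by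
  -- The dual solution: it ends at the error to be estimated and has constant norm.
  obtain ⟨z, hzh, hz⟩ := hB.exists_solution hβ hh hβh (y h - w 0 h)
  have hz' : ∀ s ∈ Icc 0 h, HasDerivWithinAt z (0 - Complex.I • Bt s (z s)) (Icc 0 h) s := by
    simpa only [zero_sub] using hz
  have hzc : ContinuousOn z (Icc 0 h) := fun s hs => (hz s hs).continuousWithinAt
  have hhI : h ∈ Icc 0 h := ⟨hh.le, le_rfl⟩
  have hzn : ‖z 0‖ = ‖y h - w 0 h‖ := by
    rw [← hB.norm_eq_of_hasDerivWithinAt hz hhI, hzh]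
  have hwcont : ∀ n ≤ 2 * J, ContinuousOn (w n) (Icc 0 h) := by
    intro n hn
    rcases hn.eq_or_lt with rfl | hn
    · exact hwc
    · exact fun s hs => (hwd n hn s hs).continuousWithinAt
  set f : ℕ → ℝ → ℝ := fun n s => (inner ℂ (z s) (w (n + 1) s)).re with hf
  have hfc : ∀ n < 2 * J, ContinuousOn (f n) (Icc 0 h) := fun n hn =>
    Complex.continuous_re.comp_continuousOn (hzc.inner (𝕜 := ℂ) (hwcont (n + 1) (by omega)))
  have hquad := abs_integral_le_of_vanish_at_nodes ht hh hJ (f := f) (M := M * ‖z 0‖) hfc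
    (fun n hn s hs => by
      simpa using hB.hasDerivWithinAt_re_inner (hz' s hs) (hwd (n + 1) (by omega) s hs))
    (fun a ha b hb hab => by
      have e : 2 * J - 1 + 1 = 2 * J := by omega
      simp only [hf, e]
      exact hB.abs_re_inner_sub_le hβ hz hwc hG hGM hwG ha hb hab)
    (fun j => by simp [hf, hw1])
  have hdiff : ∀ s ∈ Icc 0 h, HasDerivWithinAt (fun τ => (inner ℂ (z τ) (w 0 τ - y τ)).re)
      (f 0 s) (Icc 0 h) s := by
    intro s hs
    have hd : HasDerivWithinAt (fun τ => w 0 τ - y τ)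
        (w 1 s - Complex.I • Bt s (w 0 s - y s)) (Icc 0 h) s := by
      refine ((hwd 0 (by omega) s hs).sub (hy s hs)).congr_deriv ?_
      rw [map_sub, smul_sub, zero_add]
      abel
    simpa using hB.hasDerivWithinAt_re_inner (hz' s hs) hd
  have hint : ∫ s in (0 : ℝ)..h, f 0 s = -‖y h - w 0 h‖ ^ 2 := by
    rw [intervalIntegral.integral_eq_sub_of_hasDerivAt_of_le hh.le
      (fun s hs => (hdiff s hs).continuousWithinAt)
      (fun s hs => (hdiff s (Ioo_subset_Icc_self hs)).hasDerivAt (Icc_mem_nhds hs.1 hs.2))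
      (ContinuousOn.intervalIntegrable (by rw [uIcc_of_le hh.le]; exact hfc 0 (by omega))),
      hzh, hy0, sub_self, inner_zero_right, Complex.zero_re, sub_zero,
      ← neg_sub (y h), inner_neg_right, inner_self_eq_norm_sq_to_K]
    norm_cast
  rw [hint, abs_neg, abs_of_nonneg (sq_nonneg _), hzn, sq] at hquad
  -- The estimate is quadratic in the error on the left and linear on the right. A zero error cannot
  -- be divided out; then `0 ≤ M` suffices, as `M` bounds a norm almost everywhere on a set of
  -- positive measure.
  rcases (norm_nonneg (y h - w 0 h)).eq_or_lt with h0 | h0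
  · rw [← h0]
    have hM0 : 0 ≤ M := by
      obtain ⟨s, hs⟩ := (show (ae (volume.restrict (Icc 0 h))).NeBot by
        rw [ae_neBot]; simp [Measure.restrict_eq_zero, hh]) |>.nonempty_of_mem hGM
      exact (norm_nonneg _).trans hs
    positivity
  · refine le_of_mul_le_mul_right (hquad.trans_eq ?_) h0
    ring

end IsHermitianFamily

end HermitianFamily

/-! ### The interaction picture. -/

section Evolution

variable {H : Type*} [NormedAddCommGroup H] [InnerProductSpace ℂ H]

/-- A strongly continuous one-parameter group of isometries. -/
structure IsIsometryGroup (S : ℝ → H →L[ℂ] H) : Prop where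
  map_zero : S 0 = ContinuousLinearMap.id ℂ H
  map_add : ∀ s t, S (s + t) = (S s).comp (S t)
  norm_map : ∀ t x, ‖S t x‖ = ‖x‖
  continuous : ∀ x, Continuous fun t => S t x

/-- `e^{itA}` is a strongly continuous group of isometries; the fallback value in the definition of
`expI`, the constant identity, is one as well, so that Stone's theorem is not needed. -/
theorem isIsometryGroup_expI [CompleteSpace H] (A : H →ₗ.[ℂ] H) : IsIsometryGroup (expI A) := by
  unfold expI
  split_ifs with hA
  · exact ⟨hA.choose_spec.map_zero, hA.choose_spec.map_add, hA.choose_spec.norm_map,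
      hA.choose_spec.continuous⟩
  · exact ⟨rfl, fun _ _ => rfl, fun _ _ => rfl, fun _ => continuous_const⟩

/-- The potential in the interaction picture. -/
noncomputable def twist (S : ℝ → H →L[ℂ] H) (B : H →L[ℂ] H) (s : ℝ) : H →L[ℂ] H :=
  (S (-s)).comp (B.comp (S s))

namespace IsIsometryGroup

variable {S : ℝ → H →L[ℂ] H} (hS : IsIsometryGroup S)
include hS

theorem add_apply (s t : ℝ) (x : H) : S (s + t) x = S s (S t x) := by
  rw [hS.map_add]; rfl

theorem neg_apply_self (t : ℝ) (x : H) : S (-t) (S t x) = x := by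
  rw [← hS.add_apply, neg_add_cancel, hS.map_zero]; rfl

theorem self_apply_neg (t : ℝ) (x : H) : S t (S (-t) x) = x := by
  rw [← hS.add_apply, add_neg_cancel, hS.map_zero]; rfl

theorem continuous_uncurry : Continuous fun p : ℝ × H => S p.1 p.2 := by
  refine continuous_iff_continuousAt.2 fun ⟨s₀, x₀⟩ => ?_
  rw [ContinuousAt, tendsto_iff_norm_sub_tendsto_zero]
  have h1 : Filter.Tendsto (fun p : ℝ × H => ‖p.2 - x₀‖ + ‖S p.1 x₀ - S s₀ x₀‖)
      (nhds (s₀, x₀)) (nhds 0) := by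
    have hc : Continuous fun p : ℝ × H => ‖p.2 - x₀‖ + ‖S p.1 x₀ - S s₀ x₀‖ := by
      have := (hS.continuous x₀).comp (continuous_fst (X := ℝ) (Y := H))
      exact ((continuous_snd.sub continuous_const).norm).add ((this.sub continuous_const).norm)
    simpa using hc.tendsto (s₀, x₀)
  refine squeeze_zero (fun _ => norm_nonneg _) (fun p => ?_) h1
  have e : S p.1 p.2 - S s₀ x₀ = S p.1 (p.2 - x₀) + (S p.1 x₀ - S s₀ x₀) := by
    rw [map_sub]; abel
  rw [e]
  exact (norm_add_le _ _).trans_eq (by rw [hS.norm_map])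

theorem inner_map_left (t : ℝ) (x y : H) : inner ℂ (S t x) y = inner ℂ x (S (-t) y) := by
  have h1 := LinearIsometry.inner_map_map
    (⟨(S t : H →ₗ[ℂ] H), hS.norm_map t⟩ : H →ₗᵢ[ℂ] H) x (S (-t) y)
  change inner ℂ (S t x) (S t (S (-t) y)) = _ at h1
  rwa [hS.self_apply_neg] at h1

theorem integral_apply [CompleteSpace H] (τ a b : ℝ) (F : ℝ → H) :
    ∫ s in a..b, S τ (F s) = S τ (∫ s in a..b, F s) := by
  have h1 := fun μ : Measure ℝ => LinearIsometry.integral_comp_comm (μ := μ)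
    (⟨(S τ : H →ₗ[ℂ] H), hS.norm_map τ⟩ : H →ₗᵢ[ℂ] H) F
  change ∀ μ : Measure ℝ, ∫ s, S τ (F s) ∂μ = S τ (∫ s, F s ∂μ) at h1
  rw [intervalIntegral, intervalIntegral, h1, h1, map_sub]

theorem integral_sub_apply [CompleteSpace H] (τ a b : ℝ) (F : ℝ → H) :
    ∫ s in a..b, S (τ - s) (F s) = S τ (∫ s in a..b, S (-s) (F s)) := by
  rw [← hS.integral_apply]
  simp only [sub_eq_add_neg, hS.add_apply]

/-- The unbounded generator disappears under conjugation, so that bounded ODE theory applies. Only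
strong continuity of `S` is available, hence joint continuity in `(s, x)` rather than continuity in
operator norm. -/
theorem isHermitianFamily_twist {B : H →L[ℂ] H} (hB : ∀ x y, inner ℂ (B x) y = inner ℂ x (B y)) :
    IsHermitianFamily ‖B‖ (twist S B) where
  symm s x y := by
    simp only [twist, ContinuousLinearMap.comp_apply]
    rw [hS.inner_map_left, neg_neg, hB, hS.inner_map_left]
  norm_le s x := by
    simp only [twist, ContinuousLinearMap.comp_apply]
    rw [hS.norm_map]
    exact (B.le_opNorm _).trans_eq (by rw [hS.norm_map])
  continuous := by
    simp only [twist, ContinuousLinearMap.comp_apply]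
    exact hS.continuous_uncurry.comp (continuous_fst.neg.prodMk
      (B.continuous.comp hS.continuous_uncurry))

theorem continuousOn_neg_apply {w : ℝ → H} {T : Set ℝ} (hw : ContinuousOn w T) :
    ContinuousOn (fun s => S (-s) (w s)) T :=
  hS.continuous_uncurry.comp_continuousOn (continuousOn_id.neg.prodMk hw)

theorem integrableOn_neg_apply {g : ℝ → H} {T : Set ℝ} (hg : IntegrableOn g T) :
    IntegrableOn (fun s => S (-s) (g s)) T := by
  refine Integrable.mono hg ?_ (Filter.Eventually.of_forall fun s => (hS.norm_map _ _).le)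
  exact hS.continuous_uncurry.comp_aestronglyMeasurable
    (continuous_neg.aestronglyMeasurable.prodMk hg.aestronglyMeasurable)

theorem twist_neg_apply (B : H →L[ℂ] H) (s : ℝ) (x : H) :
    twist S B s (S (-s) x) = S (-s) (B x) := by
  simp only [twist, ContinuousLinearMap.comp_apply, hS.self_apply_neg]

variable [CompleteSpace H] {B : H →L[ℂ] H} {h : ℝ}

theorem hasDerivWithinAt_of_isSchrodingerSolution
    (hB : ∀ x y, inner ℂ (B x) y = inner ℂ x (B y)) {u₀ : H} {u : ℝ → H}
    (hu : IsSchrodingerSolution S B h u₀ u) {s : ℝ} (hs : s ∈ Icc 0 h) :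
    HasDerivWithinAt (fun τ => S (-τ) (u τ)) (-(Complex.I • twist S B s (S (-s) (u s))))
      (Icc 0 h) s := by
  have hc := hS.continuousOn_neg_apply hu.1
  have hc2 := (hS.isHermitianFamily_twist hB).continuousOn_apply hc
  have key : ∀ τ ∈ Icc 0 h, S (-τ) (u τ) =
      u₀ - Complex.I • ∫ s in (0 : ℝ)..τ, twist S B s (S (-s) (u s)) := by
    intro τ hτ
    rw [hu.2 τ hτ, hS.integral_sub_apply, map_sub, hS.neg_apply_self, map_smul, hS.neg_apply_self]
    simp only [hS.twist_neg_apply]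
  have h1 := ((hasDerivWithinAt_integral_of_continuousOn hc2 hs).const_smul
    Complex.I).const_sub u₀
  exact h1.congr key (key s hs)

theorem residual_eq {w g : ℝ → H} (hw : IsResidual S B h w g) {τ : ℝ} (hτ : τ ∈ Icc 0 h) :
    S (-τ) (w τ) = S (-0) (w 0) +
      ∫ s in (0 : ℝ)..τ, (S (-s) (g s) - Complex.I • twist S B s (S (-s) (w s))) := by
  rw [hw.2.2 τ hτ, hS.integral_sub_apply, _root_.map_add, hS.neg_apply_self, hS.neg_apply_self]
  simp only [hS.twist_neg_apply, map_sub, map_smul]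
  rw [neg_zero, hS.map_zero]
  rfl

theorem hasDerivWithinAt_of_isResidual (hB : ∀ x y, inner ℂ (B x) y = inner ℂ x (B y))
    {w g : ℝ → H} (hw : IsResidual S B h w g) (hg : ContinuousOn g (Icc 0 h)) {s : ℝ}
    (hs : s ∈ Icc 0 h) :
    HasDerivWithinAt (fun τ => S (-τ) (w τ))
      (S (-s) (g s) - Complex.I • twist S B s (S (-s) (w s))) (Icc 0 h) s := by
  have hc := (hS.isHermitianFamily_twist hB).continuousOn_apply (hS.continuousOn_neg_apply hw.1)
  have h1 := (hasDerivWithinAt_integral_of_continuousOn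
    ((hS.continuousOn_neg_apply hg).sub (hc.const_smul Complex.I)) hs).const_add (S (-0) (w 0))
  exact h1.congr (fun τ hτ => hS.residual_eq hw hτ) (hS.residual_eq hw hs)

end IsIsometryGroup

theorem exists_seq_of_isIteratedResidual [CompleteSpace H] {S : ℝ → H →L[ℂ] H} {B : H →L[ℂ] H}
    {h : ℝ} {n : ℕ} {w g : ℝ → H} (hg : IsIteratedResidual S B h n w g) :
    ∃ v : ℕ → ℝ → H, EqOn (v 0) w (Icc 0 h) ∧ v n = g ∧
      ∀ k < n, IsResidual S B h (v k) (v (k + 1)) := by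
  induction n generalizing g with
  | zero => exact ⟨fun _ => g, hg, rfl, by simp⟩
  | succ n ih =>
    obtain ⟨v', hv', hres⟩ := hg
    obtain ⟨v, hv0, hvn, hv⟩ := ih hv'
    refine ⟨Function.update v (n + 1) g, ?_, by simp, fun k hk => ?_⟩
    · rwa [Function.update_of_ne (by omega)]
    · rw [Function.update_of_ne (by omega)]
      rcases Nat.lt_succ_iff_lt_or_eq.1 hk with hk | rfl
      · rw [Function.update_of_ne (by omega)]
        exact hv k hk
      · rw [Function.update_self, hvn]
        exact hres

/-! ### The Picard map: norm conservation, contraction and collocation error. -/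

section Picard

variable {B : H →L[ℂ] H} {h : ℝ} {J : ℕ}

theorem continuous_sum_ell_smul (t : Fin J → ℝ) (k : Fin J → H) :
    Continuous fun s => ∑ m, ell t m s • k m :=
  continuous_finsetSum _ fun m _ => (continuous_ell t m).smul continuous_const

theorem rho_nonneg (B : H →L[ℂ] H) (hh : 0 < h) (t : Fin J → ℝ) : 0 ≤ rho B h t := by
  have : 0 ≤ ∫ s in (0 : ℝ)..h, ∑ m, |ell t m s| :=
    intervalIntegral.integral_nonneg hh.le fun s _ => Finset.sum_nonneg fun m _ => abs_nonneg _
  rw [rho, lebesgueConst]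
  positivity

variable [CompleteSpace H] {S : ℝ → H →L[ℂ] H} {t : Fin J → ℝ}

/-- The slopes of the collocation polynomial in the interaction picture. -/
noncomputable def slope (S : ℝ → H →L[ℂ] H) (B : H →L[ℂ] H) (t : Fin J → ℝ) (U : Fin J → H)
    (m : Fin J) : H := -(Complex.I • S (-t m) (B (U m)))

/-- Up to the isometry `S τ`, the Picard map is a polynomial in `τ`: ordinary Runge–Kutta
collocation for the twisted equation. -/
theorem picard_eq_integral (hS : IsIsometryGroup S) (u₀ : H) (U : Fin J → H) (τ : ℝ) :
    picard S B t u₀ U τ =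
      S τ (u₀ + ∫ s in (0 : ℝ)..τ, ∑ m, ell t m s • slope S B t U m) := by
  have e : ∀ s, ∑ m, ((ell t m s : ℝ) : ℂ) • S (τ - t m) (B (U m)) =
      S τ (∑ m, ell t m s • S (-t m) (B (U m))) := by
    intro s
    rw [map_sum]
    refine Finset.sum_congr rfl fun m _ => ?_
    rw [sub_eq_add_neg, hS.add_apply, ← Complex.coe_smul, map_smul]
  have e2 : ∀ s, ∑ m, ell t m s • slope S B t U m =
      -(Complex.I • ∑ m, ell t m s • S (-t m) (B (U m))) := by
    intro s
    rw [Finset.smul_sum, ← Finset.sum_neg_distrib]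
    refine Finset.sum_congr rfl fun m _ => ?_
    rw [slope, smul_neg, smul_comm]
  simp only [picard, e, e2]
  rw [hS.integral_apply, intervalIntegral.integral_neg, intervalIntegral.integral_smul, map_add,
    map_neg, map_smul, sub_eq_add_neg]

theorem integral_sum_ell_smul (t : Fin J → ℝ) (k : Fin J → H) (τ : ℝ) :
    ∫ s in (0 : ℝ)..τ, ∑ m, ell t m s • k m = ∑ m, (∫ s in (0 : ℝ)..τ, ell t m s) • k m := by
  rw [intervalIntegral.integral_finsetSum fun m _ => Continuous.intervalIntegrable
    (by have := continuous_ell t m; fun_prop) _ _]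
  exact Finset.sum_congr rfl fun m _ => intervalIntegral.integral_smul_const _ _

theorem picard_eq (hS : IsIsometryGroup S) (u₀ : H) (U : Fin J → H) (τ : ℝ) :
    picard S B t u₀ U τ =
      S τ (u₀ + ∑ m, (∫ s in (0 : ℝ)..τ, ell t m s) • slope S B t U m) := by
  rw [picard_eq_integral hS, integral_sum_ell_smul]

theorem picard_sub (hS : IsIsometryGroup S) (u₀ v₀ : H) (U W : Fin J → H) (τ : ℝ) :
    picard S B t u₀ U τ - picard S B t v₀ W τ = picard S B t (u₀ - v₀) (U - W) τ := by
  simp only [picard_eq hS]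
  rw [← map_sub]
  congr 1
  have : ∀ m, slope S B t (U - W) m = slope S B t U m - slope S B t W m := by
    intro m
    simp only [slope, Pi.sub_apply, map_sub, smul_sub]
    abel
  simp only [this, smul_sub, Finset.sum_sub_distrib]
  abel

/-- Gauss–Legendre collocation conserves the norm. -/
theorem norm_picard_eq (hS : IsIsometryGroup S) (hB : ∀ x y, inner ℂ (B x) y = inner ℂ x (B y))
    (ht : IsGaussLegendre h t) (hh : 0 < h) {u₀ : H} {U : Fin J → H}
    (hU : ∀ j, U j = picard S B t u₀ U (t j)) : ‖picard S B t u₀ U h‖ = ‖u₀‖ := by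
  set k := slope S B t U with hk
  set b := weight h t with hb
  -- The vector on the left is the twisted stage value, and `k n` is a skew-adjoint operator applied
  -- to it.
  have horth : ∀ n, (inner ℂ (u₀ + ∑ m, (∫ s in (0 : ℝ)..t n, ell t m s) • k m) (k n)).re = 0 := by
    intro n
    have e : S (-t n) (U n) = u₀ + ∑ m, (∫ s in (0 : ℝ)..t n, ell t m s) • k m := by
      conv_lhs => rw [hU n, picard_eq hS, hS.neg_apply_self]
    have e2 : k n = -(Complex.I • twist S B (t n) (S (-t n) (U n))) := by
      rw [hS.twist_neg_apply]; rfl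
    rw [← e, e2, inner_neg_right, inner_smul_right]
    have := (hS.isHermitianFamily_twist hB).symm (t n) (S (-t n) (U n)) (S (-t n) (U n))
    rw [← inner_conj_symm] at this
    have := Complex.conj_eq_iff_im.1 this
    simp [this]
  have hr : ∀ (r : ℝ) (x y : H), (inner ℂ (r • x) y).re = r * (inner ℂ x y).re := by
    intro r x y
    rw [← Complex.coe_smul, inner_smul_left]; simp
  have hr' : ∀ (r : ℝ) (x y : H), (inner ℂ x (r • y)).re = r * (inner ℂ x y).re := by
    intro r x y
    rw [← Complex.coe_smul, inner_smul_right]; simp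
  have hsymm : ∀ m n, (inner ℂ (k m) (k n)).re = (inner ℂ (k n) (k m)).re := by
    intro m n
    rw [← inner_conj_symm, Complex.conj_re]
  have h1 : ∀ n, (inner ℂ u₀ (k n)).re +
      ∑ m, (∫ s in (0 : ℝ)..t n, ell t m s) * (inner ℂ (k m) (k n)).re = 0 := by
    intro n
    have := horth n
    rw [inner_add_left, sum_inner, Complex.add_re, Complex.re_sum] at this
    simpa only [hr] using this
  -- Symplecticity makes the quadratic term in `‖u₀ + ∑ b m • k m‖²` cancel the cross term given by
  -- `h1`.
  have h2 : ∑ m, ∑ n, b m * b n * (inner ℂ (k m) (k n)).re =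
      2 * ∑ n, b n * ∑ m, (∫ s in (0 : ℝ)..t n, ell t m s) * (inner ℂ (k m) (k n)).re := by
    have e : ∀ m n, b m * b n * (inner ℂ (k m) (k n)).re =
        b n * (∫ s in (0 : ℝ)..t n, ell t m s) * (inner ℂ (k m) (k n)).re +
        b m * (∫ s in (0 : ℝ)..t m, ell t n s) * (inner ℂ (k n) (k m)).re := by
      intro m n
      rw [hb, weight_mul_weight ht hh m n, hsymm n m]
      ring
    simp only [e, Finset.sum_add_distrib]
    rw [two_mul]
    congr 1
    · rw [Finset.sum_comm]
      refine Finset.sum_congr rfl fun n _ => ?_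
      rw [Finset.mul_sum]
      exact Finset.sum_congr rfl fun m _ => mul_assoc _ _ _
    · refine Finset.sum_congr rfl fun n _ => ?_
      rw [Finset.mul_sum]
      exact Finset.sum_congr rfl fun m _ => mul_assoc _ _ _
  have h3 : ‖u₀ + ∑ m, b m • k m‖ ^ 2 = ‖u₀‖ ^ 2 := by
    have hn : ∀ x : H, ‖x‖ ^ 2 = (inner ℂ x x).re := fun x => by
      rw [inner_self_eq_norm_sq_to_K]; norm_cast
    rw [hn, hn, inner_add_left, inner_add_right, inner_add_right]
    simp only [Complex.add_re]
    have e1 : (inner ℂ (∑ m, b m • k m) u₀).re = (inner ℂ u₀ (∑ m, b m • k m)).re := by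
      rw [← inner_conj_symm, Complex.conj_re]
    have e2 : (inner ℂ u₀ (∑ m, b m • k m)).re = ∑ m, b m * (inner ℂ u₀ (k m)).re := by
      rw [inner_sum, Complex.re_sum]
      simp only [hr']
    have e3 : (inner ℂ (∑ m, b m • k m) (∑ m, b m • k m)).re =
        ∑ m, ∑ n, b m * b n * (inner ℂ (k m) (k n)).re := by
      rw [sum_inner, Complex.re_sum]
      simp only [inner_sum, Complex.re_sum, hr, hr', mul_assoc]
    have e4 : ∑ n, b n * (inner ℂ u₀ (k n)).re +
        ∑ n, b n * ∑ m, (∫ s in (0 : ℝ)..t n, ell t m s) * (inner ℂ (k m) (k n)).re = 0 := by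
      rw [← Finset.sum_add_distrib]
      refine Finset.sum_eq_zero fun n _ => ?_
      rw [← mul_add, h1, mul_zero]
    rw [e1, e3, e2, h2]
    linarith
  rw [picard_eq hS, hS.norm_map]
  exact (pow_left_inj₀ (norm_nonneg _) (norm_nonneg _) two_ne_zero).1 h3

theorem norm_picard_zero_le (hS : IsIsometryGroup S) (hh : 0 < h) (U : Fin J → H) {τ : ℝ}
    (hτ : τ ∈ Icc 0 h) : ‖picard S B t 0 U τ‖ ≤ rho B h t * ‖U‖ := by
  have hint : ∀ m a b, IntervalIntegrable (fun s => |ell t m s|) volume a b := fun m a b =>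
    (continuous_ell t m).abs.intervalIntegrable a b
  have e : rho B h t * ‖U‖ = ∑ m, (∫ s in (0 : ℝ)..h, |ell t m s|) * (‖B‖ * ‖U‖) := by
    rw [rho, lebesgueConst, intervalIntegral.integral_finsetSum (fun m _ => hint m _ _),
      ← Finset.sum_mul]
    field_simp
  rw [picard_eq hS, hS.norm_map, zero_add, e]
  refine (norm_sum_le _ _).trans (Finset.sum_le_sum fun m _ => ?_)
  rw [norm_smul]
  refine mul_le_mul ?_ ?_ (norm_nonneg _) (intervalIntegral.integral_nonneg hh.le fun s _ =>
    abs_nonneg _)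
  · refine (intervalIntegral.norm_integral_le_integral_norm hτ.1).trans ?_
    exact intervalIntegral.integral_mono_interval le_rfl hτ.1 hτ.2
      (Filter.Eventually.of_forall fun s => abs_nonneg _) (hint m 0 h)
  · rw [slope, norm_neg, norm_smul, Complex.norm_I, one_mul, hS.norm_map]
    exact (B.le_opNorm _).trans
      (mul_le_mul_of_nonneg_left (norm_le_pi_norm U m) (norm_nonneg _))

theorem norm_picard_sub_le (hS : IsIsometryGroup S) (hh : 0 < h) (u₀ : H) (U W : Fin J → H)
    {τ : ℝ} (hτ : τ ∈ Icc 0 h) :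
    ‖picard S B t u₀ U τ - picard S B t u₀ W τ‖ ≤ rho B h t * ‖U - W‖ := by
  rw [picard_sub hS, sub_self]
  exact norm_picard_zero_le hS hh _ hτ

/-- The collocation equations have a solution if `ρ < 1`. -/
theorem exists_collocation (hS : IsIsometryGroup S) (hh : 0 < h) (ht : IsGaussLegendre h t)
    (hρ : rho B h t < 1) (u₀ : H) : ∃ U : Fin J → H, ∀ j, U j = picard S B t u₀ U (t j) := by
  set Φ : (Fin J → H) → Fin J → H := fun U j => picard S B t u₀ U (t j) with hΦ
  have hρ0 := rho_nonneg B hh t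
  have hc : ContractingWith ⟨rho B h t, hρ0⟩ Φ := by
    refine ⟨by exact_mod_cast hρ, LipschitzWith.of_dist_le_mul fun U W => ?_⟩
    rw [dist_eq_norm, dist_eq_norm]
    refine (pi_norm_le_iff_of_nonneg (mul_nonneg hρ0 (norm_nonneg _))).2 fun j => ?_
    exact norm_picard_sub_le hS hh u₀ U W (Ioo_subset_Icc_self (ht.mem_Ioo hh j))
  exact ⟨ContractingWith.fixedPoint Φ hc, fun j => congrFun hc.fixedPoint_isFixedPt.symm j⟩

/-- The error of an inexact solution of the collocation equations. -/
theorem norm_picard_sub_le_of_residual (hS : IsIsometryGroup S) (hh : 0 < h)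
    (ht : IsGaussLegendre h t) (hρ : rho B h t < 1) {u₀ : H} {U W : Fin J → H} {ε : ℝ}
    (hU : ∀ j, U j = picard S B t u₀ U (t j))
    (hW : ‖(fun j => picard S B t u₀ W (t j)) - W‖ ≤ ε) :
    ‖picard S B t u₀ U h - picard S B t u₀ W h‖ ≤ rho B h t * ε / (1 - rho B h t) := by
  have hρ0 := rho_nonneg B hh t
  have h1 : ‖U - fun j => picard S B t u₀ W (t j)‖ ≤ rho B h t * ‖U - W‖ := by
    refine (pi_norm_le_iff_of_nonneg (mul_nonneg hρ0 (norm_nonneg _))).2 fun j => ?_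
    rw [Pi.sub_apply, hU j]
    exact norm_picard_sub_le hS hh u₀ U W (Ioo_subset_Icc_self (ht.mem_Ioo hh j))
  -- Hence `‖U - W‖ ≤ ε / (1 - ρ)`; evaluating the Picard map at `h` contributes the remaining
  -- factor `ρ`.
  have h2 : ‖U - W‖ ≤ rho B h t * ‖U - W‖ + ε := by
    have e : U - W = (U - fun j => picard S B t u₀ W (t j)) +
      ((fun j => picard S B t u₀ W (t j)) - W) := by abel
    calc ‖U - W‖ ≤ _ := by rw [e]; exact norm_add_le _ _
      _ ≤ _ := add_le_add h1 hW
  refine (norm_picard_sub_le hS hh u₀ U W ⟨hh.le, le_rfl⟩).trans ?_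
  rw [mul_div_assoc]
  refine mul_le_mul_of_nonneg_left ?_ hρ0
  rw [le_div_iff₀ (by linarith)]
  linarith

/-- At a node the Lagrange sum collapses to one slope, so the differential equation holds there
exactly. This makes the first residual vanish at the nodes. -/
theorem hasDerivWithinAt_of_isCollocationSolution (hS : IsIsometryGroup S) {u₀ : H} {u : ℝ → H}
    (hu : IsCollocationSolution S B h t u₀ u) (ht : Function.Injective t)
    (htI : ∀ j, t j ∈ Icc 0 h) (j : Fin J) :
    HasDerivWithinAt (fun τ => S (-τ) (u τ))
      (-(Complex.I • twist S B (t j) (S (-t j) (u (t j))))) (Icc 0 h) (t j) := by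
  set k := slope S B t (fun m => u (t m)) with hk
  have key : ∀ τ ∈ Icc 0 h, S (-τ) (u τ) = u₀ + ∫ s in (0 : ℝ)..τ, ∑ m, ell t m s • k m := by
    intro τ hτ
    rw [hu τ hτ, picard_eq_integral hS, hS.neg_apply_self]
  have h1 := ((continuous_sum_ell_smul t k).integral_hasStrictDerivAt 0
    (t j)).hasDerivAt.hasDerivWithinAt (s := Icc 0 h) |>.const_add u₀
  rw [sum_ell_node ht] at h1
  rw [hS.twist_neg_apply]
  exact h1.congr key (key _ (htI j))

/-- The error of the collocation method at the end of the interval. -/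
theorem norm_sub_collocation_le (hS : IsIsometryGroup S)
    (hB : ∀ x y, inner ℂ (B x) y = inner ℂ x (B y)) (hh : 0 < h) (hJ : 1 ≤ J)
    (ht : IsGaussLegendre h t) (hρ : rho B h t < 1) {u₀ : H} {u ud g : ℝ → H}
    (hu : IsSchrodingerSolution S B h u₀ u) (hud : IsCollocationSolution S B h t u₀ ud)
    (hg : IsIteratedResidual S B h (2 * J + 1) ud g)
    (hgb : MemLp g ∞ (volume.restrict (Icc 0 h))) :
    ‖u h - ud h‖ ≤ kappa J h g * h ^ (2 * J + 1) := by
  have htI : ∀ j, t j ∈ Icc 0 h := fun j => Ioo_subset_Icc_self (ht.mem_Ioo hh j)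
  have h0I : (0 : ℝ) ∈ Icc 0 h := ⟨le_rfl, hh.le⟩
  have hhI : h ∈ Icc 0 h := ⟨hh.le, le_rfl⟩
  obtain ⟨v, hv0, hvn, hv⟩ := exists_seq_of_isIteratedResidual hg
  set w : ℕ → ℝ → H := fun n s => S (-s) (v n s) with hw
  have hwd : ∀ n < 2 * J, ∀ s ∈ Icc 0 h,
      HasDerivWithinAt (w n) (w (n + 1) s - Complex.I • twist S B s (w n s)) (Icc 0 h) s :=
    fun n hn s hs => hS.hasDerivWithinAt_of_isResidual hB (hv n (by omega))
      (hv (n + 1) (by omega)).1 hs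
  have hw1 : ∀ j, w 1 (t j) = 0 := by
    intro j
    have h1 := (hasDerivWithinAt_of_isCollocationSolution hS hud ht.1.injective htI j).congr
      (f₁ := w 0) (fun s hs => by simp only [hw, hv0 hs]) (by simp only [hw, hv0 (htI j)])
    -- Two expressions for the derivative of `w 0` at a node; they differ by `w 1 (t j)`.
    have h2 := (uniqueDiffOn_Icc hh _ (htI j)).eq_deriv _ h1 (hwd 0 (by omega) _ (htI j))
    simp only [hw, hv0 (htI j), zero_add] at h2 ⊢
    rw [neg_eq_zero_sub, sub_left_inj] at h2
    exact h2.symm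
  have hβ : h * ‖B‖ < 1 := by
    refine lt_of_le_of_lt ?_ hρ
    rw [rho]
    have := one_le_lebesgueConst ht.1.injective hJ hh
    exact mul_le_mul_of_nonneg_right (le_mul_of_one_le_right hh.le this) (norm_nonneg _)
  have hres := hv (2 * J) (by omega)
  rw [hvn] at hres
  have hgM : ∀ᵐ s ∂volume.restrict (Icc 0 h), ‖S (-s) (g s)‖ ≤ normW h g := by
    have hfin : eLpNorm g (∞ : ℝ≥0∞) (volume.restrict (Icc 0 h)) ≠ (∞ : ℝ≥0∞) := hgb.2.ne
    rw [eLpNorm_exponent_top] at hfin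
    filter_upwards [ae_le_eLpNormEssSup (f := g) (μ := volume.restrict (Icc 0 h))] with s hs
    rw [hS.norm_map, normW, eLpNorm_exponent_top, ← toReal_enorm]
    exact ENNReal.toReal_mono hfin hs
  have hu0 : u 0 = u₀ := by
    rw [hu.2 0 h0I]; simp [hS.map_zero]
  have hud0 : ud 0 = u₀ := by
    rw [hud 0 h0I, picard_eq hS]; simp [hS.map_zero]
  have key := (hS.isHermitianFamily_twist hB).norm_sub_le (norm_nonneg _) hh hβ hJ ht
    (y := fun τ => S (-τ) (u τ)) (w := w) (G := fun s => S (-s) (g s))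
    (fun s hs => hS.hasDerivWithinAt_of_isSchrodingerSolution hB hu hs)
    (by simp only [hw, hv0 h0I, hu0, hud0])
    (hS.continuousOn_neg_apply hres.1) hwd hw1 (hS.integrableOn_neg_apply hres.2.1) hgM
    (fun τ hτ => hS.residual_eq hres hτ)
  simp only [hw, hv0 hhI] at key
  rw [← map_sub, hS.norm_map] at key
  exact key

end Picard

end Evolution

/-! ### Multiplication by the potential, singular values, recompression. -/

section LowRankLemmas

variable {d₁ d₂ : ℕ} {Ω₁ : Set (Eu d₁)} {Ω₂ : Set (Eu d₂)}

theorem coeFn_potential (V : Lp ℝ ∞ (muProd Ω₁ Ω₂)) (f : L2Prod Ω₁ Ω₂) :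
    potential V f =ᵐ[muProd Ω₁ Ω₂] fun x => (V x : ℂ) * f x := by
  have h1 := ContinuousLinearMap.coeFn_holder (r := 2) (ContinuousLinearMap.mul ℂ ℂ)
    (Complex.ofRealCLM.compLp V) f
  have h2 := Complex.ofRealCLM.coeFn_compLp V
  change ((ContinuousLinearMap.mul ℂ ℂ).holder 2 (Complex.ofRealCLM.compLp V) f :
    L2Prod Ω₁ Ω₂) =ᵐ[muProd Ω₁ Ω₂] _
  filter_upwards [h1, h2] with x h1 h2
  rw [h1, h2]
  simp

theorem potential_symm (V : Lp ℝ ∞ (muProd Ω₁ Ω₂)) (f g : L2Prod Ω₁ Ω₂) :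
    inner ℂ (potential V f) g = inner ℂ f (potential V g) := by
  rw [L2.inner_def, L2.inner_def]
  refine integral_congr_ae ?_
  filter_upwards [coeFn_potential V f, coeFn_potential V g] with x hf hg
  rw [hf, hg]
  simp [RCLike.inner_apply]
  ring

theorem inner_tensor (a a' : L2 Ω₁) (b b' : L2 Ω₂) :
    inner ℂ (tensor a b) (tensor a' b') = inner ℂ a a' * inner ℂ b b' := by
  rw [L2.inner_def, L2.inner_def, L2.inner_def,
    ← integral_prod_mul (fun x => inner ℂ (a x) (a' x)) (fun y => inner ℂ (b y) (b' y))]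
  refine integral_congr_ae ?_
  filter_upwards [(memLp_tensor a b).coeFn_toLp, (memLp_tensor a' b').coeFn_toLp] with x h1 h2
  rw [tensor, tensor, h1, h2]
  simp [RCLike.inner_apply]
  ring

namespace IsSVD

variable {v : L2Prod Ω₁ Ω₂} {σ : ℕ → ℝ} {a : ℕ → L2 Ω₁} {b : ℕ → L2 Ω₂}

theorem inner_term (hv : IsSVD v σ a b) (k l : ℕ) :
    inner ℂ ((σ k : ℂ) • tensor (a k) (b k)) ((σ l : ℂ) • tensor (a l) (b l)) =
      if k = l then ((σ k ^ 2 : ℝ) : ℂ) else 0 := by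
  rw [inner_smul_left, inner_smul_right, inner_tensor, Complex.conj_ofReal]
  -- Orthonormality is available only for indices with nonzero singular value; the other terms
  -- vanish because of the coefficient.
  by_cases hk : σ k = 0
  · simp [hk]
  by_cases hl : σ l = 0
  · by_cases h : k = l
    · exact absurd (h ▸ hl) hk
    · simp [hl, h]
  have h1 := (orthonormal_iff_ite.1 hv.orthonormal_left) ⟨k, hk⟩ ⟨l, hl⟩
  have h2 := (orthonormal_iff_ite.1 hv.orthonormal_right) ⟨k, hk⟩ ⟨l, hl⟩
  simp only [Subtype.mk.injEq] at h1 h2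
  rw [h1, h2]
  split_ifs with h
  · subst h; push_cast; ring
  · simp

theorem norm_sum_sq (hv : IsSVD v σ a b) (s : Finset ℕ) :
    ‖∑ k ∈ s, (σ k : ℂ) • tensor (a k) (b k)‖ ^ 2 = ∑ k ∈ s, σ k ^ 2 := by
  have h : ((‖∑ k ∈ s, (σ k : ℂ) • tensor (a k) (b k)‖ ^ 2 : ℝ) : ℂ) =
      ((∑ k ∈ s, σ k ^ 2 : ℝ) : ℂ) := by
    have := inner_self_eq_norm_sq_to_K (𝕜 := ℂ) (∑ k ∈ s, (σ k : ℂ) • tensor (a k) (b k))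
    push_cast
    refine Eq.trans this.symm ?_
    rw [sum_inner]
    refine Finset.sum_congr rfl fun k hk => ?_
    rw [inner_sum]
    simp only [hv.inner_term]
    simp [hk]
  exact_mod_cast h

/-- Pythagoras on finite sections of the tail, then the limit. -/
theorem hasSum_sq_tail (hv : IsSVD v σ a b) (r : ℕ) :
    HasSum (fun k => σ (k + r) ^ 2)
      (‖v - ∑ k ∈ Finset.range r, (σ k : ℂ) • tensor (a k) (b k)‖ ^ 2) := by
  have h1 := (hasSum_nat_add_iff' r).2 hv.hasSum
  rw [hasSum_iff_tendsto_nat_of_nonneg fun k => sq_nonneg _]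
  have h2 := (h1.tendsto_sum_nat.norm).pow 2
  refine h2.congr fun n => ?_
  have e := hv.norm_sum_sq ((Finset.range n).map (addRightEmbedding r))
  rw [Finset.sum_map, Finset.sum_map] at e
  exact e

end IsSVD

theorem IsRecompression.norm_sub_le {δ : ℝ} (hδ : 0 ≤ δ) {v w : L2Prod Ω₁ Ω₂}
    (hw : IsRecompression δ v w) : ‖v - w‖ ≤ δ := by
  obtain ⟨σ, a, b, hv, r, hr, rfl⟩ := hw
  have h1 : ∑' k, σ (k + r) ^ 2 ≤ δ ^ 2 := hr.1
  rw [(hv.hasSum_sq_tail r).tsum_eq] at h1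
  exact (sq_le_sq₀ (norm_nonneg _) hδ).1 h1

end LowRankLemmas

end LowRank

/-! ### The error bound. -/

theorem proposition4p1 {d₁ d₂ : ℕ} (Ω₁ : Set (LowRank.Eu d₁)) (Ω₂ : Set (LowRank.Eu d₂))
    (hΩ₁ : IsOpen Ω₁) (hΩ₂ : IsOpen Ω₂)
    (A : LowRank.L2Prod Ω₁ Ω₂ →ₗ.[ℂ] LowRank.L2Prod Ω₁ Ω₂) (hA : LowRank.IsLaplacian Ω₁ Ω₂ A)
    (V : Lp ℝ ∞ (LowRank.muProd Ω₁ Ω₂))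
    (J : ℕ) (hJ : 1 ≤ J) (h : ℝ) (hh : 0 < h)
    (t : Fin J → ℝ) (ht : LowRank.IsGaussLegendre h t)
    (hρ : LowRank.rho (LowRank.potential V) h t < 1)
    (ε δ : ℝ) (hδ : 0 ≤ δ)
    (u₀d u₀s : LowRank.L2Prod Ω₁ Ω₂)
    -- exact solution and collocation solution, both with initial value `u₀d`
    (u ud : ℝ → LowRank.L2Prod Ω₁ Ω₂)
    (hu : LowRank.IsSchrodingerSolution (LowRank.expI A) (LowRank.potential V) h u₀d u)
    (hud : LowRank.IsCollocationSolution (LowRank.expI A) (LowRank.potential V) h t u₀d ud)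
    -- `g = (∂ₜ - iΔ + iV)^{2J+1} ud` exists in `L^∞(0, h; L²)`
    (g : ℝ → LowRank.L2Prod Ω₁ Ω₂)
    (hg : LowRank.IsIteratedResidual (LowRank.expI A) (LowRank.potential V) h (2 * J + 1) ud g)
    (hgb : MemLp g ∞ (volume.restrict (Icc 0 h)))
    -- output of the scheme started at `u₀s`
    (uT : LowRank.L2Prod Ω₁ Ω₂)
    (huT : LowRank.IsSchemeOutput (LowRank.expI A) (LowRank.potential V) h t ε δ u₀s uT) :
    ‖u h - uT‖ ≤ δ + LowRank.rho (LowRank.potential V) h t * ε /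
        (1 - LowRank.rho (LowRank.potential V) h t) + ‖u₀d - u₀s‖ +
      LowRank.kappa J h g * h ^ (2 * J + 1) := by
  have hS := LowRank.isIsometryGroup_expI A
  have hB := LowRank.potential_symm V
  obtain ⟨_, U, K, -, -, -, hK, hrec⟩ := huT
  obtain ⟨W, hW⟩ := LowRank.exists_collocation hS hh ht hρ u₀s
  have hhI : h ∈ Icc 0 h := ⟨hh.le, le_rfl⟩
  have h1 := LowRank.norm_sub_collocation_le hS hB hh hJ ht hρ hu hud hg hgb
  have h2 : ‖ud h - LowRank.picard (LowRank.expI A) (LowRank.potential V) t u₀s W h‖ =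
      ‖u₀d - u₀s‖ := by
    rw [hud h hhI, LowRank.picard_sub hS]
    -- The difference of the two collocation solutions solves the collocation equations with initial
    -- value `u₀d - u₀s`, so the conservation law applies to it.
    refine LowRank.norm_picard_eq hS hB ht hh fun j => ?_
    rw [← LowRank.picard_sub hS, ← hW j,
      ← hud (t j) (Ioo_subset_Icc_self (LowRank.IsGaussLegendre.mem_Ioo ht hh j))]
    rfl
  have h3 := LowRank.norm_picard_sub_le_of_residual hS hh ht hρ hW hK.1
  have h4 := LowRank.IsRecompression.norm_sub_le hδ hrec
  have e1 := norm_sub_le_norm_sub_add_norm_sub (u h) (ud h) uT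
  have e2 := norm_sub_le_norm_sub_add_norm_sub (ud h)
    (LowRank.picard (LowRank.expI A) (LowRank.potential V) t u₀s W h) uT
  have e3 := norm_sub_le_norm_sub_add_norm_sub
    (LowRank.picard (LowRank.expI A) (LowRank.potential V) t u₀s W h)
    (LowRank.picard (LowRank.expI A) (LowRank.potential V) t u₀s (U K) h) uT
  linarith
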